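/- Let $X$ be a Lévy process on $\mathbb R$, possibly killed (sent to a cemetery state $\dagger$) at an independent exponential time of rate $q\ge 0$ ($q=0$ meaning no killing), with Lévy triplet $(\gamma,\sigma,\Pi)$, where $\gamma\in\mathbb R$, $\sigma\ge 0$, $\Pi(\{0\})=0$ and $\int_{\mathbb R}(x^2\wedge 1)\,\Pi(\mathrm dx)<\infty$. That is, its Lévy exponent $\psi$, defined on the imaginary axis by $\mathbb E(e^{\theta X_t};X_t\neq\dagger)=e^{\psi(\theta)t}$ for all $t\ge 0$, is $$\psi(\theta)=\gamma\theta+\tfrac12\sigma^2\theta^2+\int_{\mathbb R}\big(e^{\theta x}-1-\theta x\mathbf 1_{\{|x|<1\}}\big)\,\Pi(\mathrm dx)-q .$$ Let $\widehat X$ be a non-trivial (not identically $0$ or $\dagger$), possibly killed, Lévy process with Lévy exponent $\widehat\psi$ which is self-similar with index $1/\alpha$ for some $\alpha>0$, i.e. $(\widehat X_{ut})_{t\ge0}\overset{d}{=}(u^{1/\alpha}\widehat X_t)_{t\ge 0}$ for all $u>0$. Assume that $X$ is attracted to $\widehat X$ under zooming in: for some function $\varepsilon\mapsto a_\varepsilon>0$,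 $$\varepsilon\,\psi(\theta/a_\varepsilon)\to\widehat\psi(\theta)\qquad\text{as }\varepsilon\downarrow 0,\text{ for all purely imaginary }\theta .$$ Assume further that $\sigma=0$, and that it is not the case that almost all paths of $X$ have bounded variation on compacts (while alive) and at the same time the linear drift $\gamma'=\gamma-\int_{|x|<1}x\,\Pi(\mathrm dx)$ (well defined for such $X$) is non-zero. Then the Blumenthal–Getoor index of $X$ equals $\alpha$: $$\beta_{BG}:=\inf\Big\{\beta>0:\int_{|x|<1}|x|^\beta\,\Pi(\mathrm dx)<\infty\Big\}=\alpha .$$ -/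

import Mathlib

open MeasureTheory ProbabilityTheory Filter Topology
open scoped NNReal ENNReal

namespace LevyZoom

/-- The state space `ℝ ∪ {†}` is the one-point compactification of the line, where `† = ∞` is the
cemetery state; it carries its Borel σ-algebra. -/
instance instMeasurableSpaceOnePointReal : MeasurableSpace (OnePoint ℝ) := borel _

instance instBorelSpaceOnePointReal : BorelSpace (OnePoint ℝ) := ⟨rfl⟩

/-- Right-continuous paths with left limits, on the time axis `[0, ∞)`. -/
def IsCadlag (f : ℝ≥0 → ℝ) : Prop :=
  ∀ t, ContinuousWithinAt f (Set.Ici t) t ∧ ∃ l : ℝ, Tendsto f (𝓝[<] t) (𝓝 l)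

/-- A (non-killed) real Lévy process: it starts at `0`, has independent and stationary increments,
and almost surely has càdlàg paths. -/
structure IsLevyProcess {Ω : Type*} [MeasurableSpace Ω] (Y : ℝ≥0 → Ω → ℝ) (P : Measure Ω) :
    Prop where
  measurable : ∀ t, Measurable (Y t)
  zero : ∀ᵐ ω ∂P, Y 0 ω = 0
  indep : HasIndepIncrements Y P
  stationary : ∀ s t, IdentDistrib (fun ω => Y (s + t) ω - Y s ω) (Y t) P P
  cadlag : ∀ᵐ ω ∂P, IsCadlag (fun t => Y t ω)

/-- `ζ` is an independent exponential killing time of rate `q` for the Lévy process `Y`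
(for `q = 0` this says that `ζ = ∞` almost surely, that is, no killing). -/
structure IsKilledLevyProcess {Ω : Type*} [MeasurableSpace Ω] (Y : ℝ≥0 → Ω → ℝ) (ζ : Ω → ℝ≥0∞)
    (q : ℝ≥0) (P : Measure Ω) : Prop where
  levy : IsLevyProcess Y P
  measurable_time : Measurable ζ
  exponential : ∀ t : ℝ≥0, P {ω | (t : ℝ≥0∞) < ζ ω} = ENNReal.ofReal (Real.exp (-(q * t)))
  indep_time : IndepFun (fun ω (t : ℝ≥0) => Y t ω) ζ P

open Classical in
/-- The process `Y` sent to the cemetery state at time `ζ`. -/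
noncomputable def killed {Ω : Type*} (Y : ℝ≥0 → Ω → ℝ) (ζ : Ω → ℝ≥0∞) :
    ℝ≥0 → Ω → OnePoint ℝ :=
  fun t ω => if (t : ℝ≥0∞) < ζ ω then ((Y t ω : ℝ) : OnePoint ℝ) else OnePoint.infty

/-- `ψ` is the Lévy exponent of the process `X`: `E(e^{z X_t}; X_t ≠ †) = e^{ψ(z) t}` for all
`t ≥ 0` and all purely imaginary `z`. Only the values of `ψ` on the imaginary axis matter. -/
def HasLevyExponent {Ω : Type*} [MeasurableSpace Ω] (X : ℝ≥0 → Ω → OnePoint ℝ) (P : Measure Ω)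
    (ψ : ℂ → ℂ) : Prop :=
  ∀ (t : ℝ≥0) (θ : ℝ),
    ∫ ω, (X t ω).elim 0 (fun x : ℝ => Complex.exp ((θ * Complex.I) * x)) ∂P
      = Complex.exp (ψ (θ * Complex.I) * (t : ℝ))

/-- A Lévy triplet `(γ, σ, ν)`, with `ν` the Lévy measure. -/
structure LevyTriplet where
  γ : ℝ
  σ : ℝ
  ν : Measure ℝ
  σ_nonneg : 0 ≤ σ
  ν_zero : ν {0} = 0
  ν_lt_top : ∫⁻ x, ENNReal.ofReal (min (x ^ 2) 1) ∂ν < ∞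

open Classical in
/-- The Lévy-Khintchine formula with killing rate `q`:
`ψ(z) = γ z + σ² z² / 2 + ∫ (e^{zx} - 1 - z x 1_{|x| < 1}) ν(dx) - q`. -/
noncomputable def LevyTriplet.exponent (T : LevyTriplet) (q : ℝ≥0) (z : ℂ) : ℂ :=
  T.γ * z + (1 / 2 : ℂ) * (T.σ : ℂ) ^ 2 * z ^ 2
    + ∫ x : ℝ, (Complex.exp (z * x) - 1 - z * x * (if |x| < 1 then 1 else 0)) ∂T.ν
    - ((q : ℝ) : ℂ)

/-- The linear drift `γ' = γ - ∫_{|x| < 1} x ν(dx)` of a process with `∫_{|x| < 1} |x| ν(dx) < ∞`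
(in particular of every process of bounded variation). -/
noncomputable def LevyTriplet.drift (T : LevyTriplet) : ℝ :=
  T.γ - ∫ x in {x : ℝ | |x| < 1}, x ∂T.ν

/-- The Blumenthal-Getoor index `inf {β > 0 : ∫_{|x| < 1} |x|^β ν(dx) < ∞}`. -/
noncomputable def LevyTriplet.blumenthalGetoor (T : LevyTriplet) : ℝ :=
  sInf {β : ℝ | 0 < β ∧ ∫⁻ x in {x : ℝ | |x| < 1}, ENNReal.ofReal (|x| ^ β) ∂T.ν < ∞}

/-- Almost all paths have bounded variation on compacts (as long as the process is alive). -/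
def IsBV {Ω : Type*} [MeasurableSpace Ω] (X : ℝ≥0 → Ω → OnePoint ℝ) (P : Measure Ω) : Prop :=
  ∀ᵐ ω ∂P, LocallyBoundedVariationOn (fun t => (X t ω).elim 0 (fun x : ℝ => x))
    {t | X t ω ≠ OnePoint.infty}

/-- Self-similarity with index `H`: for all `u > 0` the processes `(X_{ut})` and `(u^H X_t)` have
the same law, i.e. the same finite-dimensional distributions (with `u^H † = †`). -/
def IsSelfSimilar {Ω : Type*} [MeasurableSpace Ω] (X : ℝ≥0 → Ω → OnePoint ℝ) (P : Measure Ω)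
    (H : ℝ) : Prop :=
  0 < H ∧ ∀ u : ℝ≥0, 0 < u →
    IdentDistrib (fun ω (t : ℝ≥0) => X (u * t) ω)
      (fun ω (t : ℝ≥0) => (X t ω).map (fun x : ℝ => (u : ℝ) ^ H * x)) P P

/-- A process is trivial if it is identically `0` or identically `†`. -/
def IsTrivialProcess {Ω : Type*} [MeasurableSpace Ω] (X : ℝ≥0 → Ω → OnePoint ℝ)
    (P : Measure Ω) : Prop :=
  (∀ t, ∀ᵐ ω ∂P, X t ω = ((0 : ℝ) : OnePoint ℝ)) ∨ (∀ t, ∀ᵐ ω ∂P, X t ω = OnePoint.infty)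

/-- Attraction under zooming in with scaling function `a`, in terms of Lévy exponents:
`ε ψ(z / a_ε) → ψ'(z)` as `ε ↓ 0`, for all purely imaginary `z`. -/
def IsAttracted (ψ ψ' : ℂ → ℂ) (a : ℝ → ℝ) : Prop :=
  (∀ ε, 0 < ε → 0 < a ε) ∧
  ∀ θ : ℝ, Tendsto (fun ε : ℝ => (ε : ℂ) * ψ ((θ * Complex.I) / (a ε : ℂ))) (𝓝[>] 0)
    (𝓝 (ψ' (θ * Complex.I)))

end LevyZoom

/-!
The idea is that all information sits in the exponent along the scales `rₙ = 1 / a(2⁻ⁿ)`.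

Let `E(θ)` be the exponent without killing at `iθ`. The laws of `rₙ Y(2⁻ⁿ)` have characteristic
functions `exp (2⁻ⁿ E(rₙ θ))`, which converge to the characteristic function of the limit process at
time `1`. Hence they are tight, so that the convergence is locally uniform. Since the limit exponent
is homogeneous of degree `α` by self-similarity and not identically zero, convergence of types gives
`rₙ₊₁ / rₙ → 2 ^ (1/α)` (`tendsto_scale_ratio`): `rₙ = 2 ^ (n/α + o(n))`.

The index is at most `α`: tightness bounds `2⁻ⁿ ∫ (1 - cos (δ rₙ x)) ν(dx)` uniformly in `n`, and a
jump `x` with `rₙ |x| ≤ 1 < rₙ₊₁ |x|` contributes at least a constant to the `n`-th integrand.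
Summing over scales, `∫ |x|^β ν(dx) ≲ ∑ 2ⁿ rₙ ^ (-β)` over the small jumps, which is finite for
`β > α` (`lintegral_rpow_lt_top`).

The index is at least `α`: if the small jumps had a finite moment of order `β < α` then, after
replacing `β` by `min β 2`, one would have `|E(θ)| ≤ C |θ|^β` for `|θ| ≥ 1`
(`LevyTriplet.norm_exponent_le_rpow`), so that `2⁻ⁿ E(rₙ θ) → 0`, and the limit exponent would
vanish. For `β < 1` this growth bound needs the linear drift to be zero. This is where the
hypothesis on bounded variation enters: summable small jumps and `σ = 0` force paths of bounded
variation (`IsKilledLevyProcess.isBV`), hence zero drift. Bounded variation is obtained directly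
from the characteristic function, without a path decomposition: `E min(|Y_t|, 1) = O(t)`, so by
Fatou the capped dyadic increments of a càdlàg path have almost surely a finite lower limit.

No distinction is made between a limit with jumps or a Gaussian part and a limit that is a pure
drift.
-/

/-! ### The exponent on the imaginary axis -/

namespace LevyZoom

lemma norm_exp_ofReal_mul_I_sub_one_le (y : ℝ) : ‖Complex.exp (y * Complex.I) - 1‖ ≤ |y| := by
  rw [mul_comm]; exact Real.norm_exp_I_mul_ofReal_sub_one_le

lemma norm_exp_ofReal_mul_I_sub_one_le_two (y : ℝ) : ‖Complex.exp (y * Complex.I) - 1‖ ≤ 2 := by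
  refine (norm_sub_le _ _).trans ?_
  rw [Complex.norm_exp_ofReal_mul_I, norm_one]; norm_num

lemma norm_exp_sub_one_sub_le_two_mul_abs (y : ℝ) :
    ‖Complex.exp (y * Complex.I) - 1 - y * Complex.I‖ ≤ 2 * |y| := by
  refine (norm_sub_le _ _).trans ?_
  have := norm_exp_ofReal_mul_I_sub_one_le y
  simp only [norm_mul, Complex.norm_real, Complex.norm_I, mul_one, Real.norm_eq_abs]
  linarith

lemma norm_exp_sub_one_sub_le_two_mul_sq (y : ℝ) :
    ‖Complex.exp (y * Complex.I) - 1 - y * Complex.I‖ ≤ 2 * y ^ 2 := by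
  have hn : ‖(y : ℂ) * Complex.I‖ = |y| := by simp
  rcases le_or_gt |y| 1 with h | h
  · have := Complex.norm_exp_sub_one_sub_id_le (x := y * Complex.I) (by rw [hn]; exact h)
    rw [hn, sq_abs] at this
    nlinarith [sq_nonneg y]
  · refine (norm_exp_sub_one_sub_le_two_mul_abs y).trans ?_
    rw [← sq_abs y]
    nlinarith

lemma norm_exp_sub_one_sub_le_rpow {β : ℝ} (h1 : 1 ≤ β) (h2 : β ≤ 2) (y : ℝ) :
    ‖Complex.exp (y * Complex.I) - 1 - y * Complex.I‖ ≤ 2 * |y| ^ β := by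
  rcases le_or_gt |y| 1 with h | h
  · refine (norm_exp_sub_one_sub_le_two_mul_sq y).trans ?_
    rw [← sq_abs y, ← Real.rpow_natCast]
    gcongr 2 * ?_
    rcases (abs_nonneg y).eq_or_lt with h0 | h0
    · rw [← h0, Real.zero_rpow (by norm_num), Real.zero_rpow (by linarith)]
    · exact Real.rpow_le_rpow_of_exponent_ge h0 h (by simpa using h2)
  · refine (norm_exp_sub_one_sub_le_two_mul_abs y).trans ?_
    gcongr 2 * ?_
    exact Real.self_le_rpow_of_one_le h.le h1

lemma norm_exp_sub_one_le_rpow {β : ℝ} (h0 : 0 < β) (h1 : β ≤ 1) (y : ℝ) :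
    ‖Complex.exp (y * Complex.I) - 1‖ ≤ 2 * |y| ^ β := by
  rcases le_or_gt |y| 1 with h | h
  · refine (norm_exp_ofReal_mul_I_sub_one_le y).trans ?_
    have := Real.self_le_rpow_of_le_one (abs_nonneg y) h h1
    have := abs_nonneg y
    linarith
  · refine (norm_exp_ofReal_mul_I_sub_one_le_two y).trans ?_
    have := Real.one_le_rpow h.le h0.le
    linarith

lemma sq_div_five_le_one_sub_cos {y : ℝ} (hy : |y| ≤ 2) : y ^ 2 / 5 ≤ 1 - Real.cos y := by
  have hpi := Real.pi_gt_three
  have hpi' := Real.pi_lt_d2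
  have h := Real.cos_le_one_sub_mul_cos_sq (x := y) (by linarith)
  have h5 : 1 / 5 ≤ 2 / Real.pi ^ 2 := by
    rw [div_le_div_iff₀ (by norm_num) (by positivity)]
    nlinarith
  nlinarith [sq_nonneg y]

namespace LevyTriplet

variable (T : LevyTriplet)

lemma integrable_min_sq_one : Integrable (fun x : ℝ => min (x ^ 2) 1) T.ν := by
  refine ⟨by fun_prop, ?_⟩
  rw [hasFiniteIntegral_iff_ofReal (Eventually.of_forall fun x => by positivity)]
  exact T.ν_lt_top

lemma measurableSet_abs_lt_one : MeasurableSet {x : ℝ | |x| < 1} :=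
  measurableSet_lt (by fun_prop) (by fun_prop)

open Classical in
lemma measurable_exponent_integrand (z : ℂ) : Measurable fun x : ℝ =>
    Complex.exp (z * x) - 1 - z * x * (if |x| < 1 then 1 else 0) := by
  have : Measurable fun x : ℝ => (if |x| < 1 then (1 : ℂ) else 0) :=
    Measurable.ite measurableSet_abs_lt_one measurable_const measurable_const
  fun_prop

open Classical in
lemma norm_exponent_integrand_le (θ x : ℝ) :
    ‖Complex.exp ((θ * Complex.I) * x) - 1 - (θ * Complex.I) * x * (if |x| < 1 then 1 else 0)‖
      ≤ (2 * θ ^ 2 + 2) * min (x ^ 2) 1 := by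
  have e : (θ * Complex.I) * x = ((θ * x : ℝ) : ℂ) * Complex.I := by push_cast; ring
  rw [e]
  split_ifs with h
  · have hx : x ^ 2 ≤ 1 := by rw [← sq_abs]; exact pow_le_one₀ (abs_nonneg x) h.le
    rw [mul_one, min_eq_left hx]
    refine (norm_exp_sub_one_sub_le_two_mul_sq _).trans ?_
    rw [mul_pow]
    nlinarith [sq_nonneg x]
  · have hx : 1 ≤ x ^ 2 := by rw [← sq_abs]; exact one_le_pow₀ (not_lt.1 h)
    rw [mul_zero, sub_zero, min_eq_right hx]
    refine (norm_exp_ofReal_mul_I_sub_one_le_two _).trans ?_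
    nlinarith [sq_nonneg θ]

open Classical in
lemma integrable_exponent_integrand (θ : ℝ) : Integrable (fun x : ℝ =>
    Complex.exp ((θ * Complex.I) * x) - 1 - (θ * Complex.I) * x * (if |x| < 1 then 1 else 0))
    T.ν :=
  (T.integrable_min_sq_one.const_mul (2 * θ ^ 2 + 2)).mono'
    (measurable_exponent_integrand _).aestronglyMeasurable
    (Eventually.of_forall fun x => norm_exponent_integrand_le θ x)

lemma exponent_eq_sub (q : ℝ≥0) (z : ℂ) : T.exponent q z = T.exponent 0 z - ((q : ℝ) : ℂ) := by
  simp [exponent]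

lemma one_sub_cos_le (y : ℝ) : 1 - Real.cos y ≤ 2 * min (y ^ 2) 1 := by
  have h1 := Real.one_sub_sq_div_two_le_cos (x := y)
  have h2 := Real.neg_one_le_cos y
  rcases le_total (y ^ 2) 1 with h | h
  · rw [min_eq_left h]; nlinarith [sq_nonneg y]
  · rw [min_eq_right h]; linarith

lemma integrable_one_sub_cos (θ : ℝ) : Integrable (fun x : ℝ => 1 - Real.cos (θ * x)) T.ν := by
  refine (T.integrable_min_sq_one.const_mul (2 * (θ ^ 2 + 1))).mono' (by fun_prop)
    (Eventually.of_forall fun x => ?_)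
  rw [Real.norm_of_nonneg (by linarith [Real.cos_le_one (θ * x)])]
  refine (one_sub_cos_le _).trans ?_
  rw [mul_assoc]
  gcongr
  rw [mul_pow]
  rcases le_total (x ^ 2) 1 with h | h
  · rw [min_eq_left h]
    refine (min_le_left _ _).trans ?_
    nlinarith [sq_nonneg x]
  · rw [min_eq_right h]
    refine (min_le_right _ _).trans ?_
    nlinarith [sq_nonneg θ]

/-- For `σ = 0`, the real part of the exponent without killing on the imaginary axis. -/
lemma re_exponent (hσ : T.σ = 0) (θ : ℝ) :
    (T.exponent 0 (θ * Complex.I)).re = -∫ x, (1 - Real.cos (θ * x)) ∂T.ν := by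
  classical
  have h := integral_re (T.integrable_exponent_integrand θ)
  simp only [RCLike.re_to_complex] at h
  simp only [exponent, hσ]
  rw [Complex.sub_re, Complex.add_re, ← h, ← integral_neg]
  simp only [Complex.ofReal_zero, NNReal.coe_zero, Complex.zero_re, sub_zero]
  have h1 : ((T.γ : ℂ) * (θ * Complex.I) + 1 / 2 * 0 ^ 2 * (θ * Complex.I) ^ 2).re = 0 := by
    simp
  rw [h1, zero_add]
  congr 1
  ext x
  have e : (θ * Complex.I) * x = ((θ * x : ℝ) : ℂ) * Complex.I := by push_cast; ring
  rw [e, Complex.sub_re, Complex.sub_re, Complex.exp_ofReal_mul_I_re]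
  split_ifs <;> simp

open Classical in
/-- A `β`-th moment of the small jumps makes the function `|x|^β` capped at `1` integrable. -/
lemma integrable_capped_rpow {β : ℝ}
    (hβ : ∫⁻ x in {x : ℝ | |x| < 1}, ENNReal.ofReal (|x| ^ β) ∂T.ν < ∞) :
    Integrable (fun x : ℝ => if |x| < 1 then |x| ^ β else 1) T.ν := by
  have h1 : IntegrableOn (fun x : ℝ => |x| ^ β) {x : ℝ | |x| < 1} T.ν := by
    refine ⟨(measurable_id.abs.pow_const β).aestronglyMeasurable, ?_⟩
    rw [hasFiniteIntegral_iff_ofReal (Eventually.of_forall fun x => by positivity)]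
    exact hβ
  have h2 : IntegrableOn (fun _ : ℝ => (1 : ℝ)) {x : ℝ | |x| < 1}ᶜ T.ν := by
    refine (T.integrable_min_sq_one.integrableOn).congr_fun ?_ measurableSet_abs_lt_one.compl
    intro x hx
    have hx' : ¬ |x| < 1 := hx
    have : 1 ≤ x ^ 2 := by rw [← sq_abs]; exact one_le_pow₀ (not_lt.1 hx')
    simp [this]
  have := Integrable.piecewise measurableSet_abs_lt_one h1 h2
  convert! this using 1

/-- Growth of the exponent: if the small jumps have a moment of order `β ≤ 2`, then the exponent
grows at most like `|θ|^β`, provided that the linear drift is absorbed (`1 ≤ β`) or absent. -/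
lemma norm_exponent_le_rpow (hσ : T.σ = 0) {β : ℝ} (h0 : 0 < β) (h2 : β ≤ 2)
    (hβ : ∫⁻ x in {x : ℝ | |x| < 1}, ENNReal.ofReal (|x| ^ β) ∂T.ν < ∞)
    (hd : 1 ≤ β ∨ T.drift = 0) :
    ∃ C, 0 ≤ C ∧ ∀ θ : ℝ, 1 ≤ |θ| → ‖T.exponent 0 (θ * Complex.I)‖ ≤ C * |θ| ^ β := by
  classical
  have hg := T.integrable_capped_rpow hβ
  set g : ℝ → ℝ := fun x => if |x| < 1 then |x| ^ β else 1 with hgdef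
  have hg0 : ∀ x, 0 ≤ g x := fun x => by simp only [hgdef]; split_ifs <;> positivity
  have key : ∀ (F : ℝ → ℂ) (θ : ℝ), (∀ x, ‖F x‖ ≤ 2 * |θ| ^ β * g x) →
      ‖∫ x, F x ∂T.ν‖ ≤ 2 * (∫ x, g x ∂T.ν) * |θ| ^ β := by
    intro F θ hF
    refine (norm_integral_le_of_norm_le (hg.const_mul _) (Eventually.of_forall hF)).trans ?_
    rw [integral_const_mul]
    exact le_of_eq (by ring)
  have hI : 0 ≤ ∫ x, g x ∂T.ν := integral_nonneg hg0
  rcases le_or_gt 1 β with h1 | h1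
  · refine ⟨|T.γ| + 2 * ∫ x, g x ∂T.ν, by positivity, fun θ hθ => ?_⟩
    have hF := key (fun x : ℝ => Complex.exp ((θ * Complex.I) * x) - 1
      - (θ * Complex.I) * x * (if |x| < 1 then 1 else 0)) θ ?_
    · simp only [exponent, hσ]
      have e : (T.γ : ℂ) * (θ * Complex.I) + 1 / 2 * ((0 : ℝ) : ℂ) ^ 2 * (θ * Complex.I) ^ 2
          = T.γ * (θ * Complex.I) := by simp
      rw [e, NNReal.coe_zero, Complex.ofReal_zero, sub_zero]
      refine (norm_add_le _ _).trans ?_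
      rw [add_mul]
      refine add_le_add ?_ hF
      simp only [norm_mul, Complex.norm_real, Complex.norm_I, mul_one, Real.norm_eq_abs]
      gcongr
      exact Real.self_le_rpow_of_one_le hθ h1
    · intro x
      have e : (θ * Complex.I) * x = ((θ * x : ℝ) : ℂ) * Complex.I := by push_cast; ring
      rw [e]
      simp only [hgdef]
      split_ifs with h
      · rw [mul_one, mul_assoc, ← Real.mul_rpow (abs_nonneg _) (abs_nonneg _), ← abs_mul]
        exact norm_exp_sub_one_sub_le_rpow h1 h2 _
      · rw [mul_zero, sub_zero, mul_one]
        refine (norm_exp_ofReal_mul_I_sub_one_le_two _).trans ?_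
        have := Real.one_le_rpow hθ h0.le
        linarith
  · have hd0 : T.drift = 0 := hd.resolve_left (not_le.2 h1)
    refine ⟨2 * ∫ x, g x ∂T.ν, by positivity, fun θ hθ => ?_⟩
    have hb : ∀ x : ℝ, ‖Complex.exp ((θ * Complex.I) * x) - 1‖ ≤ 2 * |θ| ^ β * g x := by
      intro x
      have e : (θ * Complex.I) * x = ((θ * x : ℝ) : ℂ) * Complex.I := by push_cast; ring
      rw [e]
      simp only [hgdef]
      split_ifs with h
      · rw [mul_assoc, ← Real.mul_rpow (abs_nonneg _) (abs_nonneg _), ← abs_mul]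
        exact norm_exp_sub_one_le_rpow h0 h1.le _
      · refine (norm_exp_ofReal_mul_I_sub_one_le_two _).trans ?_
        have := Real.one_le_rpow hθ h0.le
        linarith
    have hi1 : Integrable (fun x : ℝ => Complex.exp ((θ * Complex.I) * x) - 1) T.ν :=
      (hg.const_mul (2 * |θ| ^ β)).mono' (by fun_prop) (Eventually.of_forall hb)
    have hi2 : Integrable (fun x : ℝ => (θ * Complex.I) * x * (if |x| < 1 then (1 : ℂ) else 0))
        T.ν := by
      have := hi1.sub (T.integrable_exponent_integrand θ)
      refine this.congr (Eventually.of_forall fun x => ?_)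
      simp
    have hx : ∫ x : ℝ, (θ * Complex.I) * x * (if |x| < 1 then (1 : ℂ) else 0) ∂T.ν
        = (θ * Complex.I) * ((∫ x in {x : ℝ | |x| < 1}, x ∂T.ν : ℝ) : ℂ) := by
      rw [← integral_complex_ofReal, ← integral_indicator measurableSet_abs_lt_one, ← integral_const_mul]
      congr 1
      ext x
      by_cases h : |x| < 1 <;> simp [Set.indicator, h]
    have hm : T.exponent 0 (θ * Complex.I)
        = T.drift * (θ * Complex.I) + ∫ x : ℝ, (Complex.exp ((θ * Complex.I) * x) - 1) ∂T.ν := by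
      simp only [exponent, hσ, drift]
      rw [integral_sub hi1 hi2, hx]
      push_cast
      simp
      ring
    rw [hm, hd0, Complex.ofReal_zero, zero_mul, zero_add]
    exact key _ θ hb

end LevyTriplet

/-! ### Bounded variation of càdlàg paths through capped dyadic increments -/

/-- A càdlàg path is bounded on compact time intervals. -/
lemma IsCadlag.exists_bound {f : ℝ≥0 → ℝ} (hf : IsCadlag f) (N : ℝ≥0) :
    ∃ M : ℝ, ∀ t ∈ Set.Icc 0 N, |f t| ≤ M := by
  refine isCompact_Icc.induction_on (p := fun s => ∃ M : ℝ, ∀ t ∈ s, |f t| ≤ M)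
    ⟨0, by simp⟩ (fun s t hst ⟨M, hM⟩ => ⟨M, fun u hu => hM u (hst hu)⟩) ?_ ?_
  · rintro s t ⟨M, hM⟩ ⟨M', hM'⟩
    refine ⟨max M M', fun u hu => ?_⟩
    rcases hu with hu | hu
    · exact (hM u hu).trans (le_max_left _ _)
    · exact (hM' u hu).trans (le_max_right _ _)
  · intro t _
    obtain ⟨hr, l, hl⟩ := hf t
    have h1 : ∀ᶠ u in 𝓝[≥] t, |f u| ≤ |f t| + 1 :=
      (hr.abs.eventually_lt_const (lt_add_one _)).mono fun _ h => h.le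
    have h2 : ∀ᶠ u in 𝓝[<] t, |f u| ≤ |l| + 1 :=
      (hl.abs.eventually_lt_const (lt_add_one _)).mono fun _ h => h.le
    have h3 : ∀ᶠ u in 𝓝 t, |f u| ≤ max (|f t| + 1) (|l| + 1) := by
      rw [← nhdsLT_sup_nhdsGE t, eventually_sup]
      exact ⟨h2.mono fun _ h => h.trans (le_max_right _ _),
        h1.mono fun _ h => h.trans (le_max_left _ _)⟩
    exact ⟨_, mem_nhdsWithin_of_mem_nhds h3, _, fun u hu => hu⟩

lemma eVariationOn_nat_Icc (g : ℕ → ℝ) (n : ℕ) :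
    eVariationOn g (Set.Icc 0 n) = ∑ k ∈ Finset.range n, edist (g k) (g (k + 1)) := by
  rw [← eVariationOn.sum' g (I := fun i : ℕ => i) monotone_id]
  refine Finset.sum_congr rfl fun k _ => ?_
  rw [← eVariationOn.pair]
  congr 1
  ext i
  simp only [Set.mem_Icc, Set.mem_insert_iff, Set.mem_singleton_iff]
  omega

lemma tendsto_ceil_dyadic (t : ℝ≥0) :
    Tendsto (fun m : ℕ => ((⌈t * 2 ^ m⌉₊ : ℝ≥0) / 2 ^ m)) atTop (𝓝[≥] t) := by
  refine tendsto_nhdsWithin_iff.2 ⟨?_, Eventually.of_forall fun m => ?_⟩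
  · rw [← NNReal.tendsto_coe]
    have h := (tendsto_nat_ceil_mul_div_atTop (R := ℝ) t.2).comp
      (tendsto_pow_atTop_atTop_of_one_lt (one_lt_two : (1 : ℝ) < 2))
    refine h.congr fun m => ?_
    simp only [Function.comp, NNReal.coe_div, NNReal.coe_natCast, NNReal.coe_pow, NNReal.coe_ofNat]
    congr 2
  · rw [Set.mem_Ici, le_div_iff₀ (by positivity)]
    exact Nat.le_ceil _

/-- A càdlàg path has bounded variation as soon as the sums of its dyadic increments, each capped
at `1`, do not tend to infinity: the path is bounded, so that capping loses only a constant factor,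
and the variation is lower semicontinuous under the dyadic approximation from the right. -/
lemma IsCadlag.boundedVariationOn {f : ℝ≥0 → ℝ} (hf : IsCadlag f) (N : ℕ)
    (h : liminf (fun m : ℕ => ∑ k ∈ Finset.range (N * 2 ^ m), ENNReal.ofReal
      (min |f ((k : ℝ≥0) / 2 ^ m + 1 / 2 ^ m) - f ((k : ℝ≥0) / 2 ^ m)| 1)) atTop ≠ ∞) :
    BoundedVariationOn f (Set.Icc 0 (N : ℝ≥0)) := by
  obtain ⟨M, hM⟩ := hf.exists_bound N
  set W : ℕ → ℝ≥0∞ := fun m : ℕ => ∑ k ∈ Finset.range (N * 2 ^ m), ENNReal.ofReal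
      (min |f ((k : ℝ≥0) / 2 ^ m + 1 / 2 ^ m) - f ((k : ℝ≥0) / 2 ^ m)| 1) with hW
  set F : ℕ → ℝ≥0 → ℝ := fun m t => f ((⌈t * 2 ^ m⌉₊ : ℝ≥0) / 2 ^ m) with hF
  set K : ℝ := max 1 (2 * M) with hK
  have hFW : ∀ m, eVariationOn (F m) (Set.Icc 0 (N : ℝ≥0)) ≤ ENNReal.ofReal K * W m := by
    intro m
    have h1 : eVariationOn (F m) (Set.Icc 0 (N : ℝ≥0))
        ≤ eVariationOn (fun k : ℕ => f ((k : ℝ≥0) / 2 ^ m)) (Set.Icc 0 (N * 2 ^ m)) := by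
      refine eVariationOn.comp_le_of_monotoneOn (fun k : ℕ => f ((k : ℝ≥0) / 2 ^ m))
        (fun t : ℝ≥0 => ⌈t * 2 ^ m⌉₊) ?_ ?_
      · intro a _ b _ hab
        exact Nat.ceil_mono (by gcongr)
      · intro t ht
        refine ⟨Nat.zero_le _, Nat.ceil_le.2 ?_⟩
        push_cast
        gcongr
        exact ht.2
    refine h1.trans ?_
    rw [eVariationOn_nat_Icc, hW, Finset.mul_sum]
    refine Finset.sum_le_sum fun k hk => ?_
    rw [Finset.mem_range] at hk
    have hmem : ∀ j : ℕ, j ≤ N * 2 ^ m → (j : ℝ≥0) / 2 ^ m ∈ Set.Icc 0 (N : ℝ≥0) := by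
      intro j hj
      refine ⟨zero_le, ?_⟩
      rw [div_le_iff₀ (by positivity)]
      exact_mod_cast hj
    have ek : (k : ℝ≥0) / 2 ^ m + 1 / 2 ^ m = ((k + 1 : ℕ) : ℝ≥0) / 2 ^ m := by
      push_cast; rw [add_div]
    rw [ek, edist_comm, edist_dist, Real.dist_eq, ← ENNReal.ofReal_mul (by positivity)]
    refine ENNReal.ofReal_le_ofReal ?_
    have a1 := hM _ (hmem k hk.le)
    have a2 := hM _ (hmem (k + 1) hk)
    set d := |f (((k + 1 : ℕ) : ℝ≥0) / 2 ^ m) - f ((k : ℝ≥0) / 2 ^ m)|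
    have hd : d ≤ 2 * M := (abs_sub _ _).trans (by linarith)
    have hd0 : 0 ≤ d := abs_nonneg _
    rcases le_total d 1 with h' | h'
    · rw [min_eq_left h']
      have : 1 ≤ K := le_max_left _ _
      nlinarith
    · rw [min_eq_right h', mul_one]
      exact hd.trans (le_max_right _ _)
  have hlim : ∀ t ∈ Set.Icc 0 (N : ℝ≥0), Tendsto (fun m => F m t) atTop (𝓝 (f t)) :=
    fun t _ => (hf t).1.tendsto.comp (tendsto_ceil_dyadic t)
  intro htop
  obtain ⟨b, hb1, hb2⟩ := exists_between (lt_top_iff_ne_top.2 h)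
  have hfr : ∃ᶠ m in atTop, W m < b := frequently_lt_of_liminf_lt (by isBoundedDefault) hb1
  have hKb : ENNReal.ofReal K * b < ∞ := ENNReal.mul_lt_top ENNReal.ofReal_lt_top hb2
  have hev := eVariationOn.lowerSemicontinuous_aux hlim (v := ENNReal.ofReal K * b)
    (by rw [htop]; exact hKb)
  obtain ⟨m, hm1, hm2⟩ := (hfr.and_eventually hev).exists
  exact absurd ((hm2.trans_le (hFW m)).trans_le (mul_le_mul_right hm1.le _)) (lt_irrefl _)

/-! ### Dyadic cosine series and elementary exponential bounds -/

lemma sum_min_dyadic_le (n : ℕ) : ∀ s : ℝ, 0 ≤ s →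
    ∑ i ∈ Finset.range n, (1 / 2 : ℝ) ^ i * min ((2 ^ i * s) ^ 2) 1
      ≤ if s ≤ 1 then 4 * s - 2 * s ^ 2 else 2 := by
  induction n with
  | zero =>
    intro s hs
    rw [Finset.sum_range_zero]
    split_ifs <;> nlinarith
  | succ n ih =>
    intro s hs
    have h := ih (2 * s) (by linarith)
    rw [Finset.sum_range_succ']
    have e : ∑ i ∈ Finset.range n, (1 / 2 : ℝ) ^ (i + 1) * min ((2 ^ (i + 1) * s) ^ 2) 1
        = 1 / 2 * ∑ i ∈ Finset.range n, (1 / 2 : ℝ) ^ i * min ((2 ^ i * (2 * s)) ^ 2) 1 := by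
      rw [Finset.mul_sum]
      refine Finset.sum_congr rfl fun i _ => ?_
      rw [show (2 : ℝ) ^ (i + 1) * s = 2 ^ i * (2 * s) by ring]
      ring
    rw [e]
    simp only [pow_zero, one_mul]
    have m1 := min_le_left (s ^ 2) 1
    have m2 := min_le_right (s ^ 2) 1
    split_ifs at h with h2
    · rw [if_pos (by linarith)]
      nlinarith
    · split_ifs with h1
      · nlinarith
      · linarith

/-- The dyadic series `∑ 2⁻ⁿ min((2ⁿ s)², 1)` is comparable to `min(s, 1)`. -/
lemma tsum_min_dyadic_le {s : ℝ} (hs : 0 ≤ s) :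
    ∑' n : ℕ, ENNReal.ofReal ((1 / 2) ^ n * min ((2 ^ n * s) ^ 2) 1)
      ≤ ENNReal.ofReal (4 * min s 1) := by
  refine ENNReal.tsum_le_of_sum_range_le fun n => ?_
  rw [← ENNReal.ofReal_sum_of_nonneg fun i _ => by positivity]
  refine ENNReal.ofReal_le_ofReal ((sum_min_dyadic_le n s hs).trans ?_)
  split_ifs with h
  · rw [min_eq_left h]; nlinarith
  · rw [min_eq_right (not_le.1 h).le]; norm_num

/-- The capped absolute value is dominated by a dyadic cosine series, away from large values. -/
lemma min_abs_one_le_tsum (z : ℝ) :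
    ENNReal.ofReal (min |z| 1) ≤
      10 * ∑' n : ℕ, ENNReal.ofReal ((1 / 2) ^ n * (1 - Real.cos (2 ^ n * z)))
        + {x : ℝ | 1 < |x|}.indicator 1 z := by
  by_cases hz : 1 < |z|
  · rw [Set.indicator_of_mem (by exact hz), min_eq_right hz.le]
    simp
  rw [Set.indicator_of_notMem (by exact hz), add_zero]
  rw [not_lt] at hz
  rw [min_eq_left hz]
  rcases (abs_nonneg z).eq_or_lt with h0 | h0
  · rw [← h0]; simp
  -- the first dyadic scale at which `z` is visible
  have hex : ∃ n : ℕ, 1 ≤ 2 ^ n * |z| := by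
    obtain ⟨n, hn⟩ := pow_unbounded_of_one_lt (1 / |z|) (one_lt_two)
    exact ⟨n, by rw [div_lt_iff₀ h0] at hn; exact hn.le⟩
  classical
  obtain ⟨n, hn1, hn2⟩ : ∃ n : ℕ, 1 ≤ 2 ^ n * |z| ∧ 2 ^ n * |z| ≤ 2 := by
    refine ⟨Nat.find hex, Nat.find_spec hex, ?_⟩
    rcases hk : Nat.find hex with _ | k
    · simp; linarith
    · have := Nat.find_min hex (m := k) (by omega)
      rw [pow_succ]; linarith
  have habs : |2 ^ n * z| = 2 ^ n * |z| := by rw [abs_mul, abs_of_pos (by positivity)]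
  have hcos : 1 / 5 ≤ 1 - Real.cos (2 ^ n * z) := by
    have := sq_div_five_le_one_sub_cos (y := 2 ^ n * z) (by rw [habs]; exact hn2)
    rw [← sq_abs, habs] at this
    have h6 : 1 ≤ (2 ^ n * |z|) ^ 2 := one_le_pow₀ hn1
    linarith
  refine le_trans ?_ (mul_le_mul_right (ENNReal.le_tsum n) 10)
  rw [show (10 : ℝ≥0∞) = ENNReal.ofReal 10 by simp, ← ENNReal.ofReal_mul (by norm_num)]
  refine ENNReal.ofReal_le_ofReal ?_
  have hp : (0 : ℝ) < (1 / 2) ^ n := by positivity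
  have e : (1 / 2 : ℝ) ^ n * 2 ^ n = 1 := by rw [← mul_pow]; norm_num
  have : |z| = (1 / 2 : ℝ) ^ n * (2 ^ n * |z|) := by rw [← mul_assoc, e, one_mul]
  rw [this]
  nlinarith

lemma norm_one_sub_exp_le {w : ℂ} (hw : w.re ≤ 0) : ‖1 - Complex.exp w‖ ≤ 2 * ‖w‖ := by
  rw [norm_sub_rev]
  rcases le_or_gt ‖w‖ 1 with h | h
  · exact Complex.norm_exp_sub_one_le h
  · refine (norm_sub_le _ _).trans ?_
    rw [Complex.norm_exp, norm_one]
    have := Real.exp_le_one_iff.2 hw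
    linarith

lemma one_sub_re_exp_le {w : ℂ} (hw : w.re ≤ 0) :
    1 - (Complex.exp w).re ≤ -w.re + 2 * min (w.im ^ 2) 1 := by
  rw [Complex.exp_re]
  have h1 := Real.exp_le_one_iff.2 hw
  have h2 := Real.exp_pos w.re
  have h3 := Real.add_one_le_exp w.re
  have h4 := LevyTriplet.one_sub_cos_le w.im
  have h5 := Real.cos_le_one w.im
  nlinarith

lemma re_exponent_nonpos (T : LevyTriplet) (hσ : T.σ = 0) (θ : ℝ) :
    (T.exponent 0 (θ * Complex.I)).re ≤ 0 := by
  rw [T.re_exponent hσ, neg_nonpos]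
  exact integral_nonneg fun x => by simpa using Real.cos_le_one (θ * x)

lemma norm_exponent_le (T : LevyTriplet) (hσ : T.σ = 0) (θ : ℝ) :
    ‖T.exponent 0 (θ * Complex.I)‖
      ≤ |T.γ| * |θ| + (2 * θ ^ 2 + 2) * ∫ x, min (x ^ 2) 1 ∂T.ν := by
  simp only [LevyTriplet.exponent, hσ]
  have e : (T.γ : ℂ) * (θ * Complex.I) + 1 / 2 * ((0 : ℝ) : ℂ) ^ 2 * (θ * Complex.I) ^ 2
      = T.γ * (θ * Complex.I) := by simp
  rw [e, NNReal.coe_zero, Complex.ofReal_zero, sub_zero]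
  refine (norm_add_le _ _).trans (add_le_add ?_ ?_)
  · simp
  · rw [← integral_const_mul]
    exact norm_integral_le_of_norm_le (T.integrable_min_sq_one.const_mul _)
      (Eventually.of_forall fun x => LevyTriplet.norm_exponent_integrand_le θ x)

/-! ### Bounded variation of Lévy processes with summable small jumps -/

lemma integral_cos_eq_re_charFun (μ : Measure ℝ) [IsProbabilityMeasure μ] (θ : ℝ) :
    ∫ z, Real.cos (θ * z) ∂μ = (charFun μ θ).re := by
  rw [charFun_apply_real]
  have hi : Integrable (fun z : ℝ => Complex.exp (θ * z * Complex.I)) μ := by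
    refine Integrable.of_bound (by fun_prop) 1 (Eventually.of_forall fun z => ?_)
    rw [← Complex.ofReal_mul, Complex.norm_exp_ofReal_mul_I]
  have := integral_re hi
  simp only [RCLike.re_to_complex] at this
  rw [← this]
  congr 1
  ext z
  rw [← Complex.ofReal_mul, Complex.exp_ofReal_mul_I_re]

/-- If the small jumps are summable, the capped absolute moment of an infinitely divisible law
with exponent `t ψ` is `O(t)`, uniformly in `t`. -/
lemma exists_lintegral_min_abs_le (T : LevyTriplet) (hσ : T.σ = 0)
    (hm : ∫⁻ x in {x : ℝ | |x| < 1}, ENNReal.ofReal (|x| ^ (1 : ℝ)) ∂T.ν < ∞) :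
    ∃ C : ℝ, 0 ≤ C ∧ ∀ (μ : Measure ℝ) [IsProbabilityMeasure μ] (t : ℝ), 0 ≤ t →
      (∀ θ : ℝ, charFun μ θ = Complex.exp (T.exponent 0 (θ * Complex.I) * t)) →
      ∫⁻ z, ENNReal.ofReal (min |z| 1) ∂μ ≤ ENNReal.ofReal (C * t) := by
  classical
  have hJi : Integrable (fun x : ℝ => min |x| 1) T.ν := by
    refine (T.integrable_capped_rpow hm).congr (Eventually.of_forall fun x => ?_)
    simp only [Real.rpow_one]
    split_ifs with h
    · rw [min_eq_left h.le]
    · rw [min_eq_right (not_lt.1 h)]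
  obtain ⟨C₁, hC₁, hgrow⟩ := T.norm_exponent_le_rpow hσ one_pos one_le_two hm (Or.inl le_rfl)
  set J := ∫ x : ℝ, min |x| 1 ∂T.ν with hJ
  have hJ0 : 0 ≤ J := integral_nonneg fun x => by positivity
  set I₂ := ∫ x : ℝ, min (x ^ 2) 1 ∂T.ν with hI₂
  have hI₂0 : 0 ≤ I₂ := integral_nonneg fun x => by positivity
  set M := |T.γ| * 2 + 10 * I₂ with hM
  have hM0 : 0 ≤ M := by positivity
  refine ⟨10 * (8 * J + 8 * C₁) + 4 * M, by positivity, fun μ _ t ht hμ => ?_⟩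
  have hre : ∀ θ : ℝ, (T.exponent 0 (θ * Complex.I) * t).re ≤ 0 := fun θ => by
    rw [Complex.re_mul_ofReal]
    exact mul_nonpos_of_nonpos_of_nonneg (re_exponent_nonpos T hσ θ) ht
  -- the large values, through the tail bound for characteristic functions
  have htail : μ {x : ℝ | 1 < |x|} ≤ ENNReal.ofReal (4 * M * t) := by
    have h := measureReal_abs_gt_le_integral_charFun (μ := μ) (r := 1) one_pos
    have hb : ‖∫ θ in (-2 * (1 : ℝ)⁻¹)..(2 * (1 : ℝ)⁻¹), 1 - charFun μ θ‖
        ≤ (2 * (M * t)) * |2 * (1 : ℝ)⁻¹ - (-2 * (1 : ℝ)⁻¹)| := by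
      refine intervalIntegral.norm_integral_le_of_norm_le_const fun θ hθ => ?_
      rw [Set.uIoc_of_le (by norm_num)] at hθ
      have hθ2 : |θ| ≤ 2 := abs_le.2 ⟨by have := hθ.1; norm_num at this; linarith,
        by have := hθ.2; norm_num at this; linarith⟩
      rw [hμ]
      refine (norm_one_sub_exp_le (hre θ)).trans ?_
      rw [norm_mul, Complex.norm_real, Real.norm_of_nonneg ht]
      gcongr
      refine (norm_exponent_le T hσ θ).trans ?_
      have : θ ^ 2 ≤ 4 := by rw [← sq_abs]; nlinarith [abs_nonneg θ]
      rw [hM]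
      gcongr
      linarith
    rw [← ENNReal.ofReal_toReal (measure_ne_top μ {x : ℝ | 1 < |x|})]
    refine ENNReal.ofReal_le_ofReal (h.trans ?_)
    norm_num at hb ⊢
    linarith
  -- one dyadic scale
  have hscale : ∀ n : ℕ, ∫⁻ z, ENNReal.ofReal ((1 / 2) ^ n * (1 - Real.cos (2 ^ n * z))) ∂μ
      ≤ ENNReal.ofReal t *
          ∫⁻ x, ENNReal.ofReal ((1 / 2) ^ n * (1 - Real.cos (2 ^ n * x))) ∂T.ν
        + 2 * ENNReal.ofReal ((1 / 2) ^ n * min ((2 ^ n * (C₁ * t)) ^ 2) 1) := by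
    intro n
    have hnn : ∀ z : ℝ, 0 ≤ (1 / 2 : ℝ) ^ n * (1 - Real.cos (2 ^ n * z)) := fun z =>
      mul_nonneg (by positivity) (by linarith [Real.cos_le_one (2 ^ n * z)])
    have hcosi : Integrable (fun z : ℝ => Real.cos (2 ^ n * z)) μ :=
      Integrable.of_bound (by fun_prop) 1 (Eventually.of_forall fun z => by
        simpa using Real.abs_cos_le_one (2 ^ n * z))
    have hsub : Integrable (fun z : ℝ => (1 / 2 : ℝ) ^ n * (1 - Real.cos (2 ^ n * z))) μ :=
      ((integrable_const 1).sub hcosi).const_mul _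
    rw [← ofReal_integral_eq_lintegral_ofReal hsub
        (Eventually.of_forall hnn),
      ← ofReal_integral_eq_lintegral_ofReal ((T.integrable_one_sub_cos (2 ^ n)).const_mul _)
        (Eventually.of_forall hnn),
      show (2 : ℝ≥0∞) = ENNReal.ofReal 2 by simp, ← ENNReal.ofReal_mul ht,
      ← ENNReal.ofReal_mul zero_le_two,
      ← ENNReal.ofReal_add (mul_nonneg ht (integral_nonneg hnn)) (by positivity)]
    refine ENNReal.ofReal_le_ofReal ?_
    rw [integral_const_mul, integral_const_mul, integral_sub (integrable_const 1) hcosi,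
      integral_cos_eq_re_charFun, hμ]
    simp only [integral_const, probReal_univ, smul_eq_mul, mul_one]
    have h1 := one_sub_re_exp_le (hre (2 ^ n))
    have h2 := hgrow (2 ^ n) (by rw [abs_of_pos (by positivity)]; exact one_le_pow₀ one_le_two)
    rw [Real.rpow_one, abs_of_pos (by positivity)] at h2
    rw [Complex.re_mul_ofReal, Complex.im_mul_ofReal, T.re_exponent hσ] at h1
    have h3 : ((T.exponent 0 (((2 ^ n : ℝ) : ℂ) * Complex.I)).im * t) ^ 2
        ≤ (2 ^ n * (C₁ * t)) ^ 2 := by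
      rw [← sq_abs, abs_mul, abs_of_nonneg ht]
      refine pow_le_pow_left₀ (by positivity) ?_ 2
      have := (Complex.abs_im_le_norm _).trans h2
      nlinarith
    have h4 := min_le_min_right (1 : ℝ) h3
    have hp : (0 : ℝ) < (1 / 2) ^ n := by positivity
    have h5 := mul_le_mul_of_nonneg_left (h1.trans (add_le_add_right
      (mul_le_mul_of_nonneg_left h4 zero_le_two) _)) hp.le
    refine h5.trans (le_of_eq ?_)
    ring
  have hpt : ∀ x : ℝ, ∑' n : ℕ, ENNReal.ofReal ((1 / 2) ^ n * (1 - Real.cos (2 ^ n * x)))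
      ≤ ENNReal.ofReal (8 * min |x| 1) := by
    intro x
    calc _ ≤ ∑' n : ℕ, 2 * ENNReal.ofReal ((1 / 2) ^ n * min ((2 ^ n * |x|) ^ 2) 1) := by
          refine ENNReal.tsum_le_tsum fun n => ?_
          rw [show (2 : ℝ≥0∞) = ENNReal.ofReal 2 by simp, ← ENNReal.ofReal_mul zero_le_two]
          refine ENNReal.ofReal_le_ofReal ?_
          have := LevyTriplet.one_sub_cos_le (2 ^ n * x)
          have e : (2 ^ n * |x|) ^ 2 = (2 ^ n * x) ^ 2 := by rw [mul_pow, mul_pow, sq_abs]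
          rw [e]
          have hp : (0 : ℝ) < (1 / 2) ^ n := by positivity
          nlinarith
      _ ≤ 2 * ENNReal.ofReal (4 * min |x| 1) := by
          rw [ENNReal.tsum_mul_left]
          gcongr
          exact tsum_min_dyadic_le (abs_nonneg x)
      _ = _ := by
          rw [show (2 : ℝ≥0∞) = ENNReal.ofReal 2 by simp, ← ENNReal.ofReal_mul zero_le_two]
          congr 1; ring
  have hmeas : ∀ n : ℕ, Measurable fun z : ℝ =>
      ENNReal.ofReal ((1 / 2) ^ n * (1 - Real.cos (2 ^ n * z))) := fun n => by fun_prop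
  calc ∫⁻ z, ENNReal.ofReal (min |z| 1) ∂μ
      ≤ ∫⁻ z, (10 * ∑' n : ℕ, ENNReal.ofReal ((1 / 2) ^ n * (1 - Real.cos (2 ^ n * z)))
        + {x : ℝ | 1 < |x|}.indicator 1 z) ∂μ := lintegral_mono min_abs_one_le_tsum
    _ = 10 * ∑' n : ℕ, ∫⁻ z, ENNReal.ofReal ((1 / 2) ^ n * (1 - Real.cos (2 ^ n * z))) ∂μ
        + μ {x : ℝ | 1 < |x|} := by
        rw [lintegral_add_left ((Measurable.tsum hmeas).const_mul _),
          lintegral_const_mul _ (Measurable.tsum hmeas),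
          lintegral_tsum fun n => (hmeas n).aemeasurable,
          lintegral_indicator_one (measurableSet_lt (by fun_prop) (by fun_prop))]
    _ ≤ 10 * (ENNReal.ofReal t * ENNReal.ofReal (8 * J) + 2 * ENNReal.ofReal (4 * (C₁ * t)))
        + ENNReal.ofReal (4 * M * t) := by
        refine add_le_add (mul_le_mul_right ((ENNReal.tsum_le_tsum hscale).trans ?_) 10) htail
        rw [ENNReal.tsum_add, ENNReal.tsum_mul_left, ENNReal.tsum_mul_left,
          ← lintegral_tsum fun n => (hmeas n).aemeasurable]
        refine add_le_add (mul_le_mul_right ?_ _) (mul_le_mul_right ?_ _)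
        · rw [hJ, ← integral_const_mul, ofReal_integral_eq_lintegral_ofReal (hJi.const_mul 8)
            (Eventually.of_forall fun x => by positivity)]
          exact lintegral_mono hpt
        · refine (tsum_min_dyadic_le (by positivity)).trans (ENNReal.ofReal_le_ofReal ?_)
          gcongr
          exact min_le_left _ _
    _ = ENNReal.ofReal ((10 * (8 * J + 8 * C₁) + 4 * M) * t) := by
        rw [show (2 : ℝ≥0∞) = ENNReal.ofReal 2 by simp,
          show (10 : ℝ≥0∞) = ENNReal.ofReal 10 by simp, ← ENNReal.ofReal_mul ht,
          ← ENNReal.ofReal_mul zero_le_two, ← ENNReal.ofReal_add (by positivity) (by positivity),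
          ← ENNReal.ofReal_mul (by norm_num), ← ENNReal.ofReal_add (by positivity) (by positivity)]
        congr 1
        ring

/-- A Lévy process without Gaussian part and with summable small jumps has paths of bounded
variation on compacts. -/
lemma IsLevyProcess.ae_boundedVariationOn {Ω : Type*} [MeasurableSpace Ω] {P : Measure Ω}
    [IsProbabilityMeasure P] {Y : ℝ≥0 → Ω → ℝ} (hY : IsLevyProcess Y P) (T : LevyTriplet)
    (hσ : T.σ = 0)
    (hch : ∀ (t : ℝ≥0) (θ : ℝ),
      charFun (P.map (Y t)) θ = Complex.exp (T.exponent 0 (θ * Complex.I) * (t : ℝ)))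
    (hm : ∫⁻ x in {x : ℝ | |x| < 1}, ENNReal.ofReal (|x| ^ (1 : ℝ)) ∂T.ν < ∞) :
    ∀ᵐ ω ∂P, ∀ N : ℕ, BoundedVariationOn (fun t => Y t ω) (Set.Icc 0 (N : ℝ≥0)) := by
  obtain ⟨C, hC, hbound⟩ := exists_lintegral_min_abs_le T hσ hm
  rw [ae_all_iff]
  intro N
  set W : ℕ → Ω → ℝ≥0∞ := fun m ω => ∑ k ∈ Finset.range (N * 2 ^ m), ENNReal.ofReal
      (min |Y ((k : ℝ≥0) / 2 ^ m + 1 / 2 ^ m) ω - Y ((k : ℝ≥0) / 2 ^ m) ω| 1) with hW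
  have hmeas : ∀ s t : ℝ≥0, Measurable fun ω => ENNReal.ofReal (min |Y s ω - Y t ω| 1) := by
    intro s t
    have h1 := hY.measurable s
    have h2 := hY.measurable t
    fun_prop
  have hWm : ∀ m, Measurable (W m) := fun m =>
    Finset.measurable_fun_sum _ fun k _ => hmeas _ _
  have hW1 : ∀ m, ∫⁻ ω, W m ω ∂P ≤ ENNReal.ofReal (N * C) := by
    intro m
    rw [lintegral_finsetSum _ fun k _ => hmeas _ _]
    have hterm : ∀ k ∈ Finset.range (N * 2 ^ m), ∫⁻ ω, ENNReal.ofReal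
        (min |Y ((k : ℝ≥0) / 2 ^ m + 1 / 2 ^ m) ω - Y ((k : ℝ≥0) / 2 ^ m) ω| 1) ∂P
        ≤ ENNReal.ofReal (C * ((1 / 2 ^ m : ℝ≥0) : ℝ)) := by
      intro k _
      set h : ℝ≥0 := 1 / 2 ^ m
      have hid := (hY.stationary ((k : ℝ≥0) / 2 ^ m) h).comp
        (u := fun z : ℝ => ENNReal.ofReal (min |z| 1)) (by fun_prop)
      have heq := hid.lintegral_eq
      simp only [Function.comp] at heq
      have : IsProbabilityMeasure (P.map (Y h)) :=
        Measure.isProbabilityMeasure_map (hY.measurable h).aemeasurable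
      rw [heq]
      refine le_trans (le_of_eq ?_) (hbound (P.map (Y h)) h h.2 (hch h))
      rw [lintegral_map (by fun_prop) (hY.measurable h)]
    refine (Finset.sum_le_sum hterm).trans (le_of_eq ?_)
    rw [Finset.sum_const, Finset.card_range, nsmul_eq_mul, ← ENNReal.ofReal_natCast,
      ← ENNReal.ofReal_mul (by positivity)]
    congr 1
    push_cast
    field_simp
  have hfin : ∫⁻ ω, liminf (fun m => W m ω) atTop ∂P ≠ ∞ := by
    refine ne_top_of_le_ne_top (ENNReal.ofReal_ne_top (r := N * C)) ((lintegral_liminf_le hWm).trans ?_)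
    refine (liminf_le_limsup).trans ?_
    exact limsup_le_of_le (by isBoundedDefault) (Eventually.of_forall hW1)
  filter_upwards [hY.cadlag, ae_lt_top (Measurable.liminf hWm) hfin] with ω h1 h2
  exact h1.boundedVariationOn N h2.ne

/-! ### Killing and self-similarity -/

section Killing

variable {Ω : Type*} [MeasurableSpace Ω] {P : Measure Ω}
  {Y : ℝ≥0 → Ω → ℝ} {ζ : Ω → ℝ≥0∞} {q : ℝ≥0}

/-- By independence, killing multiplies the characteristic function by the survival probability. -/
lemma IsKilledLevyProcess.integral_elim_killed (h : IsKilledLevyProcess Y ζ q P) (t : ℝ≥0)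
    (θ : ℝ) :
    ∫ ω, (killed Y ζ t ω).elim 0 (fun x : ℝ => Complex.exp ((θ * Complex.I) * x)) ∂P
      = charFun (P.map (Y t)) θ * Complex.exp (-((q : ℝ) : ℂ) * (t : ℝ)) := by
  classical
  have hmY := h.levy.measurable t
  have hind : IndepFun (fun ω => Complex.exp ((θ * Complex.I) * Y t ω))
      (fun ω => {s : ℝ≥0∞ | (t : ℝ≥0∞) < s}.indicator (1 : ℝ≥0∞ → ℂ) (ζ ω)) P :=
    h.indep_time.comp (φ := fun f : ℝ≥0 → ℝ => Complex.exp ((θ * Complex.I) * f t))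
      (ψ := {s : ℝ≥0∞ | (t : ℝ≥0∞) < s}.indicator (1 : ℝ≥0∞ → ℂ))
      (by fun_prop) (measurable_one.indicator measurableSet_Ioi)
  have hζ : Measurable fun ω => {s : ℝ≥0∞ | (t : ℝ≥0∞) < s}.indicator (1 : ℝ≥0∞ → ℂ) (ζ ω) :=
    (measurable_one.indicator measurableSet_Ioi).comp h.measurable_time
  have e1 : ∀ ω, (killed Y ζ t ω).elim 0 (fun x : ℝ => Complex.exp ((θ * Complex.I) * x))
      = Complex.exp ((θ * Complex.I) * Y t ω)
        * {s : ℝ≥0∞ | (t : ℝ≥0∞) < s}.indicator (1 : ℝ≥0∞ → ℂ) (ζ ω) := by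
    intro ω
    by_cases hω : (t : ℝ≥0∞) < ζ ω <;> simp [killed, hω]
  simp_rw [e1]
  rw [hind.integral_fun_mul_eq_mul_integral (by fun_prop) hζ.aestronglyMeasurable]
  congr 1
  · rw [charFun_apply_real, integral_map hmY.aemeasurable (by fun_prop)]
    refine integral_congr_ae (Eventually.of_forall fun ω => ?_)
    simp only
    ring_nf
  · have e2 : (fun ω => {s : ℝ≥0∞ | (t : ℝ≥0∞) < s}.indicator (1 : ℝ≥0∞ → ℂ) (ζ ω))
        = {ω | (t : ℝ≥0∞) < ζ ω}.indicator 1 := by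
      ext ω
      by_cases hω : (t : ℝ≥0∞) < ζ ω <;> simp [hω]
    rw [e2, integral_indicator (measurableSet_lt measurable_const h.measurable_time)]
    simp only [Pi.one_apply, integral_const, measureReal_def, Measure.restrict_apply_univ,
      h.exponential, ENNReal.toReal_ofReal (Real.exp_nonneg _), Complex.real_smul, mul_one]
    push_cast
    ring_nf

lemma IsKilledLevyProcess.charFun_eq (h : IsKilledLevyProcess Y ζ q P) {ψ : ℂ → ℂ}
    (hψ : HasLevyExponent (killed Y ζ) P ψ) (t : ℝ≥0) (θ : ℝ) :
    charFun (P.map (Y t)) θ = Complex.exp ((ψ (θ * Complex.I) + ((q : ℝ) : ℂ)) * (t : ℝ)) := by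
  have h1 := hψ t θ
  rw [h.integral_elim_killed] at h1
  rw [add_mul, Complex.exp_add, ← h1, mul_assoc, ← Complex.exp_add, neg_mul, neg_add_cancel,
    Complex.exp_zero, mul_one]

/-- A killed Lévy process without Gaussian part and with summable small jumps has paths of
bounded variation. -/
lemma IsKilledLevyProcess.isBV [IsProbabilityMeasure P] (h : IsKilledLevyProcess Y ζ q P) (T : LevyTriplet)
    (hσ : T.σ = 0) (hψ : HasLevyExponent (killed Y ζ) P (T.exponent q))
    (hm : ∫⁻ x in {x : ℝ | |x| < 1}, ENNReal.ofReal (|x| ^ (1 : ℝ)) ∂T.ν < ∞) :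
    IsBV (killed Y ζ) P := by
  have hch : ∀ (t : ℝ≥0) (θ : ℝ),
      charFun (P.map (Y t)) θ = Complex.exp (T.exponent 0 (θ * Complex.I) * (t : ℝ)) := by
    intro t θ
    rw [h.charFun_eq hψ, T.exponent_eq_sub q, sub_add_cancel]
  filter_upwards [h.levy.ae_boundedVariationOn T hσ hch hm] with ω hω
  intro a b _ _
  obtain ⟨N, hN⟩ := exists_nat_ge b
  have hbv : BoundedVariationOn (fun t => Y t ω)
      ({t | killed Y ζ t ω ≠ OnePoint.infty} ∩ Set.Icc a b) :=
    (hω N).mono fun t ht => ⟨zero_le, ht.2.2.trans hN⟩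
  refine ne_of_eq_of_ne (eVariationOn.congr fun t ht => ?_) hbv
  have ht' : killed Y ζ t ω ≠ OnePoint.infty := ht.1
  by_cases hlt : (t : ℝ≥0∞) < ζ ω
  · simp [killed, hlt]
  · simp [killed, hlt] at ht'

end Killing

section SelfSimilar

lemma eq_of_exp_mul_eq {A B : ℂ}
    (h : ∀ t : ℝ, 0 < t → Complex.exp (A * t) = Complex.exp (B * t)) : A = B := by
  have hpos : (0 : ℝ) < 1 + ‖A - B‖ := by positivity
  have h1 := h (1 / (1 + ‖A - B‖)) (by positivity)
  set t : ℝ := 1 / (1 + ‖A - B‖) with ht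
  have ht0 : 0 < t := by positivity
  rw [Complex.exp_eq_exp_iff_exists_int] at h1
  obtain ⟨n, hn⟩ := h1
  have h2 : (A - B) * t = n * (2 * Real.pi * Complex.I) := by rw [sub_mul, hn]; ring
  have h3 : ‖(A - B) * t‖ < 1 := by
    rw [norm_mul, Complex.norm_real, Real.norm_of_nonneg ht0.le, ht, mul_one_div,
      div_lt_one hpos]
    linarith
  have h4 : n = 0 := by
    by_contra hn0
    have h5 : (1 : ℝ) ≤ |(n : ℝ)| := by exact_mod_cast Int.one_le_abs hn0
    rw [h2, norm_mul, norm_mul, norm_mul, Complex.norm_I, Complex.norm_real, Complex.norm_intCast,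
      Real.norm_of_nonneg Real.pi_pos.le, Complex.norm_ofNat] at h3
    nlinarith [Real.pi_gt_three]
  rw [h4, Int.cast_zero, zero_mul, mul_eq_zero] at h2
  rcases h2 with h2 | h2
  · exact sub_eq_zero.1 h2
  · exact absurd (Complex.ofReal_eq_zero.1 h2) ht0.ne'

lemma measurable_elim_exp (θ : ℝ) : Measurable fun y : OnePoint ℝ =>
    y.elim (0 : ℂ) (fun x : ℝ => Complex.exp ((θ * Complex.I) * x)) := by
  have hemb : MeasurableEmbedding ((↑) : ℝ → OnePoint ℝ) :=
    OnePoint.isOpenEmbedding_coe.measurableEmbedding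
  have hm := hemb.measurable_extend
    (g := fun x : ℝ => Complex.exp ((θ * Complex.I) * x)) (g' := fun _ => (0 : ℂ))
    (by fun_prop) measurable_const
  convert! hm using 1
  ext y
  induction y using OnePoint.rec with
  | infty =>
    rw [Function.extend_apply']
    · simp
    · rintro ⟨x, hx⟩
      exact OnePoint.coe_ne_infty x hx
  | coe x => rw [hemb.injective.extend_apply]; simp

/-- The exponent of a self-similar process is homogeneous of degree `α` along the imaginary
axis. -/
lemma IsSelfSimilar.exponent_mul {Ω : Type*} [MeasurableSpace Ω] {P : Measure Ω}
    {X : ℝ≥0 → Ω → OnePoint ℝ} {α : ℝ} (hα : 0 < α) (hss : IsSelfSimilar X P (1 / α))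
    {ψ : ℂ → ℂ} (hψ : HasLevyExponent X P ψ) {c : ℝ} (hc : 0 < c) (θ : ℝ) :
    ψ (((c * θ : ℝ) : ℂ) * Complex.I) = ((c ^ α : ℝ) : ℂ) * ψ (θ * Complex.I) := by
  obtain ⟨u, hu⟩ : ∃ u : ℝ≥0, (u : ℝ) = c ^ α := ⟨⟨c ^ α, by positivity⟩, rfl⟩
  have hu0 : 0 < u := by rw [← NNReal.coe_pos, hu]; positivity
  have hcu : (u : ℝ) ^ (1 / α) = c := by
    rw [hu, ← Real.rpow_mul hc.le, mul_one_div_cancel hα.ne', Real.rpow_one]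
  refine eq_of_exp_mul_eq fun t ht => ?_
  lift t to ℝ≥0 using ht.le
  have hid := (hss.2 u hu0).comp (u := fun f : ℝ≥0 → OnePoint ℝ =>
    (f t).elim (0 : ℂ) (fun x : ℝ => Complex.exp ((θ * Complex.I) * x)))
    ((measurable_elim_exp θ).comp (measurable_pi_apply t))
  have heq := hid.integral_eq
  simp only [Function.comp] at heq
  rw [hψ (u * t) θ] at heq
  rw [← hψ t (c * θ)]
  have e : ∀ ω, ((X t ω).map (fun x : ℝ => (u : ℝ) ^ (1 / α) * x)).elim (0 : ℂ)
      (fun x : ℝ => Complex.exp ((θ * Complex.I) * x))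
      = (X t ω).elim 0 (fun x : ℝ => Complex.exp ((((c * θ : ℝ) : ℂ) * Complex.I) * x)) := by
    intro ω
    rw [hcu]
    induction X t ω using OnePoint.rec with
    | infty => simp
    | coe x =>
      simp only [OnePoint.map_some, OnePoint.elim_some]
      congr 1
      push_cast
      ring
  simp_rw [e] at heq
  rw [← heq, NNReal.coe_mul, hu]
  congr 1
  push_cast
  ring

/-- A non-trivial Lévy process with killing rate `0` has an exponent which is not identically zero
on the imaginary axis. -/
lemma exists_exponent_ne_zero {Ω : Type*} [MeasurableSpace Ω] {P : Measure Ω}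
    [IsProbabilityMeasure P] {Y : ℝ≥0 → Ω → ℝ} {ζ : Ω → ℝ≥0∞} {q : ℝ≥0}
    (h : IsKilledLevyProcess Y ζ q P) {ψ : ℂ → ℂ} (hψ : HasLevyExponent (killed Y ζ) P ψ)
    (hq : q = 0) (hnt : ¬ IsTrivialProcess (killed Y ζ) P) :
    ∃ θ : ℝ, ψ (θ * Complex.I) ≠ 0 := by
  by_contra! h0
  refine hnt (Or.inl fun t => ?_)
  have hY0 : P.map (Y t) = Measure.dirac 0 := by
    have := Measure.isProbabilityMeasure_map (μ := P) (h.levy.measurable t).aemeasurable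
    refine Measure.ext_of_charFun ?_
    ext θ
    rw [h.charFun_eq hψ, h0, hq]
    simp
  have hYae : ∀ᵐ ω ∂P, Y t ω = 0 := by
    have : ∀ᵐ y ∂(P.map (Y t)), y = 0 := by
      rw [hY0]
      simp [ae_dirac_eq]
    exact ae_of_ae_map (h.levy.measurable t).aemeasurable this
  have hζ : ∀ᵐ ω ∂P, (t : ℝ≥0∞) < ζ ω := by
    have hm : MeasurableSet {ω | (t : ℝ≥0∞) < ζ ω} :=
      measurableSet_lt measurable_const h.measurable_time
    have := h.exponential t
    rw [hq] at this
    rw [ae_iff, ← Set.compl_ofPred, prob_compl_eq_one_sub hm, this]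
    simp
  filter_upwards [hYae, hζ] with ω h1 h2
  simp [killed, h1, h2]

end SelfSimilar

/-! ### Locally uniform convergence and convergence of types -/

/-- The characteristic functions of a tight family of probability measures are uniformly
equicontinuous. -/
lemma exists_norm_charFun_sub_le {μ : ℕ → Measure ℝ} [∀ n, IsProbabilityMeasure (μ n)]
    (ht : IsTightMeasureSet (Set.range μ)) {ε : ℝ} (hε : 0 < ε) :
    ∃ δ > 0, ∀ n s t, |s - t| ≤ δ → ‖charFun (μ n) s - charFun (μ n) t‖ ≤ ε := by
  have h1 := tendsto_measure_norm_gt_of_isTightMeasureSet ht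
  have h2 := (h1.eventually_le_const (u := ENNReal.ofReal (ε / 4))
    (by simpa using hε)).and (eventually_gt_atTop (0 : ℝ))
  obtain ⟨R, hR, hR0⟩ := h2.exists
  have htail : ∀ n, (μ n).real {x | R < ‖x‖} ≤ ε / 4 := by
    intro n
    refine ENNReal.toReal_le_of_le_ofReal (by positivity) (le_trans ?_ hR)
    exact le_iSup₂_of_le (μ n) (Set.mem_range_self n) le_rfl
  refine ⟨ε / (2 * R), by positivity, fun n s t hst => ?_⟩
  have hint : ∀ u : ℝ, Integrable (fun x : ℝ => Complex.exp (u * x * Complex.I)) (μ n) := by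
    intro u
    refine Integrable.of_bound (by fun_prop) 1 (Eventually.of_forall fun z => ?_)
    rw [← Complex.ofReal_mul, Complex.norm_exp_ofReal_mul_I]
  have hms : MeasurableSet {x : ℝ | R < ‖x‖} := measurableSet_lt (by fun_prop) (by fun_prop)
  rw [charFun_apply_real, charFun_apply_real, ← integral_sub (hint s) (hint t)]
  have hg : Integrable (fun x : ℝ => ε / 2 + {x : ℝ | R < ‖x‖}.indicator (fun _ => (2 : ℝ)) x)
      (μ n) := (integrable_const _).add ((integrable_const _).indicator hms)
  refine (norm_integral_le_of_norm_le hg (Eventually.of_forall fun x => ?_)).trans ?_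
  · have e : Complex.exp (s * x * Complex.I) - Complex.exp (t * x * Complex.I)
        = Complex.exp (((t * x : ℝ) : ℂ) * Complex.I)
          * (Complex.exp ((((s - t) * x : ℝ) : ℂ) * Complex.I) - 1) := by
      rw [mul_sub, ← Complex.exp_add, mul_one]
      congr 2 <;> push_cast <;> ring
    rw [e, norm_mul, Complex.norm_exp_ofReal_mul_I, one_mul]
    by_cases hx : R < ‖x‖
    · rw [Set.indicator_of_mem (by exact hx)]
      refine (norm_exp_ofReal_mul_I_sub_one_le_two _).trans ?_
      linarith
    · rw [Set.indicator_of_notMem (by exact hx), add_zero]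
      refine (norm_exp_ofReal_mul_I_sub_one_le _).trans ?_
      rw [abs_mul]
      have hx' : |x| ≤ R := not_lt.1 hx
      calc |s - t| * |x| ≤ ε / (2 * R) * R := by gcongr
        _ = ε / 2 := by field_simp
  · rw [integral_add (integrable_const _) ((integrable_const _).indicator hms),
      integral_indicator hms]
    simp only [integral_const, probReal_univ, measureReal_restrict_apply_univ,
      smul_eq_mul]
    linarith [htail n]

/-- Locally uniform convergence of characteristic functions, along an arbitrary filter. -/
lemma tendsto_charFun_of_tendsto {μ : ℕ → Measure ℝ} [∀ n, IsProbabilityMeasure (μ n)]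
    (ht : IsTightMeasureSet (Set.range μ)) {F : ℝ → ℂ}
    (hF : ∀ θ, Tendsto (fun n => charFun (μ n) θ) atTop (𝓝 (F θ)))
    {ι : Type*} {l : Filter ι} {k : ι → ℕ} (hk : Tendsto k l atTop) {u : ι → ℝ} {u₀ : ℝ}
    (hu : Tendsto u l (𝓝 u₀)) :
    Tendsto (fun i => charFun (μ (k i)) (u i)) l (𝓝 (F u₀)) := by
  have h1 := (hF u₀).comp hk
  have h2 : Tendsto (fun i => charFun (μ (k i)) (u i) - charFun (μ (k i)) u₀) l (𝓝 0) := by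
    rw [Metric.tendsto_nhds]
    intro ε hε
    obtain ⟨δ, hδ, h⟩ := exists_norm_charFun_sub_le ht (half_pos hε)
    filter_upwards [Metric.tendsto_nhds.1 hu δ hδ] with i hi
    rw [dist_zero_right]
    rw [Real.dist_eq] at hi
    exact (h _ _ _ hi.le).trans_lt (half_lt_self hε)
  have h3 := h2.add h1
  simpa using h3

/-- Convergence of types along the scales `2⁻ⁿ`: if the laws with exponent `2⁻ⁿ E(rₙ θ)` converge
to a law with non-zero exponent `Ψ`, homogeneous of degree `α`, then `rₙ₊₁ / rₙ → 2 ^ (1/α)`.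
Every limit point `c ∈ [0, ∞]` of the ratios satisfies `exp (Ψ (c θ)) = exp (2 Ψ θ)` when `c` is
finite, and `exp Ψ = 1` otherwise. -/
lemma tendsto_scale_ratio {μ : ℕ → Measure ℝ} [∀ n, IsProbabilityMeasure (μ n)]
    {E Ψ : ℝ → ℂ} {r : ℕ → ℝ} {α : ℝ} (hα : 0 < α) (hr : ∀ n, 0 < r n)
    (hμ : ∀ n θ, charFun (μ n) θ = Complex.exp (E (r n * θ) * ((1 / 2 : ℝ) ^ n : ℝ)))
    (ht : IsTightMeasureSet (Set.range μ))
    (hlim : ∀ θ, Tendsto (fun n => charFun (μ n) θ) atTop (𝓝 (Complex.exp (Ψ θ))))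
    (hΨ : ∀ c, 0 ≤ c → ∀ θ, Ψ (c * θ) = ((c ^ α : ℝ) : ℂ) * Ψ θ) {θ₀ : ℝ} (hθ₀ : Ψ θ₀ ≠ 0) :
    Tendsto (fun n => r (n + 1) / r n) atTop (𝓝 (2 ^ (1 / α))) := by
  have hstep : ∀ n θ, charFun (μ (n + 1)) θ ^ 2 = charFun (μ n) (r (n + 1) / r n * θ) := by
    intro n θ
    rw [hμ, hμ, ← Complex.exp_nat_mul, show r n * (r (n + 1) / r n * θ) = r (n + 1) * θ by
      have := (hr n).ne'; field_simp]
    congr 1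
    push_cast
    ring
  have hpos : ∀ n, 0 < r (n + 1) / r n := fun n => div_pos (hr _) (hr _)
  -- homogeneity turns an identity between exponentials into one between exponents
  have hunwind : ∀ d : ℂ, (∀ θ, Complex.exp (d * Ψ θ) = Complex.exp (2 * Ψ θ)) → d = 2 := by
    intro d hd
    refine mul_right_cancel₀ hθ₀ (eq_of_exp_mul_eq fun t ht => ?_)
    have h := hd (t ^ (1 / α) * θ₀)
    rw [hΨ _ (by positivity), ← Real.rpow_mul ht.le, one_div_mul_cancel hα.ne',
      Real.rpow_one] at h
    rw [show d * Ψ θ₀ * t = d * (t * Ψ θ₀) by ring, h]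
    congr 1
    ring
  rw [tendsto_iff_ultrafilter]
  intro g hg
  have hsucc : Tendsto (fun n : ℕ => n + 1) (g : Filter ℕ) atTop :=
    (tendsto_add_atTop_nat 1).mono_left hg
  have hid : Tendsto (fun n : ℕ => n) (g : Filter ℕ) atTop := hg
  by_cases hB : ∃ B : ℝ, ∀ᶠ n in (g : Filter ℕ), r (n + 1) / r n ≤ B
  · obtain ⟨B, hB⟩ := hB
    have hmem : ∀ᶠ n in (g : Filter ℕ), r (n + 1) / r n ∈ Set.Icc 0 B :=
      hB.mono fun n h => ⟨(hpos n).le, h⟩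
    obtain ⟨c, hc, hgc⟩ := (isCompact_Icc (a := (0 : ℝ)) (b := B)).ultrafilter_le_nhds
      (g.map fun n => r (n + 1) / r n) (le_principal_iff.2 hmem)
    have hgc' : Tendsto (fun n => r (n + 1) / r n) (g : Filter ℕ) (𝓝 c) := hgc
    have hd : ((c ^ α : ℝ) : ℂ) = 2 := by
      refine hunwind _ fun θ => ?_
      have l1 := tendsto_charFun_of_tendsto ht hlim hid (hgc'.mul_const θ)
      have l2 := ((hlim θ).comp hsucc).pow 2
      have l3 := tendsto_nhds_unique l1 (l2.congr fun n => hstep n θ)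
      rw [hΨ c hc.1] at l3
      rw [l3, ← Complex.exp_nat_mul]
      norm_num
    have hd' : c ^ α = 2 := by exact_mod_cast hd
    have hcc : c = 2 ^ (1 / α) := by
      rw [← hd', ← Real.rpow_mul hc.1, mul_one_div_cancel hα.ne', Real.rpow_one]
    rw [← hcc]
    exact hgc'
  · exfalso
    simp only [not_exists, ← Ultrafilter.eventually_not, not_le] at hB
    have hinf : Tendsto (fun n => r (n + 1) / r n) (g : Filter ℕ) atTop := by
      rw [tendsto_atTop]
      intro B
      exact (hB B).mono fun n h => h.le
    have h02 : (0 : ℂ) = 2 := by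
      refine hunwind 0 fun θ => ?_
      have l1 := ((hlim θ).comp hid)
      have l2 := (tendsto_charFun_of_tendsto ht hlim hsucc
        ((tendsto_inv_atTop_zero.comp hinf).mul_const θ)).pow 2
      have e : ∀ n, charFun (μ (n + 1)) ((Inv.inv ∘ fun n => r (n + 1) / r n) n * θ) ^ 2
          = charFun (μ n) θ := by
        intro n
        rw [hstep, Function.comp, mul_inv_cancel_left₀ (hpos n).ne']
      have l3 := tendsto_nhds_unique l1 (l2.congr e)
      have h0 := hΨ 0 le_rfl 0
      rw [Real.zero_rpow hα.ne', Complex.ofReal_zero, zero_mul, zero_mul] at h0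
      rw [zero_mul, h0, Complex.exp_zero, one_pow] at l3
      have e2 : Complex.exp (2 * Ψ θ) = Complex.exp (Ψ θ) ^ 2 := by
        rw [← Complex.exp_nat_mul]; norm_num
      rw [zero_mul, Complex.exp_zero, e2, l3, one_pow]
    norm_num at h02

/-! ### Moments of the small jumps along the scales -/

/-- If `rₙ₊₁ / rₙ → κ` and `2 < κ ^ β`, then `∑ 2ⁿ rₙ ^ (-β) < ∞`. -/
lemma summable_two_pow_mul_rpow_neg {r : ℕ → ℝ} (hr : ∀ n, 0 < r n) {κ β : ℝ} (hκ : 0 < κ)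
    (hlim : Tendsto (fun n => r (n + 1) / r n) atTop (𝓝 κ)) (h : 2 < κ ^ β) :
    Summable fun n : ℕ => 2 ^ n * r n ^ (-β) := by
  have hpos : ∀ n, 0 < 2 ^ n * r n ^ (-β) := fun n =>
    mul_pos (by positivity) (Real.rpow_pos_of_pos (hr n) _)
  refine summable_of_ratio_test_tendsto_lt_one (l := 2 * κ ^ (-β)) ?_
    (Eventually.of_forall fun n => (hpos n).ne') ?_
  · rw [Real.rpow_neg hκ.le, ← div_eq_mul_inv, div_lt_one (by positivity)]
    exact h
  · have h1 := (hlim.rpow_const (p := -β) (Or.inl hκ.ne')).const_mul 2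
    refine h1.congr fun n => ?_
    rw [Real.norm_of_nonneg (hpos _).le, Real.norm_of_nonneg (hpos _).le,
      Real.div_rpow (hr _).le (hr _).le, pow_succ]
    have := Real.rpow_pos_of_pos (hr n) (-β)
    field_simp

/-- If `rₙ₊₁ / rₙ → κ` and `κ ^ β < 2`, then `rₙ ^ β = o(2ⁿ)`. -/
lemma tendsto_half_pow_mul_rpow {r : ℕ → ℝ} (hr : ∀ n, 0 < r n) {κ β : ℝ} (hκ : 0 < κ)
    (hlim : Tendsto (fun n => r (n + 1) / r n) atTop (𝓝 κ)) (h : κ ^ β < 2) :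
    Tendsto (fun n : ℕ => (1 / 2 : ℝ) ^ n * r n ^ β) atTop (𝓝 0) := by
  have hpos : ∀ n, 0 < (1 / 2 : ℝ) ^ n * r n ^ β := fun n =>
    mul_pos (by positivity) (Real.rpow_pos_of_pos (hr n) _)
  refine (summable_of_ratio_test_tendsto_lt_one (l := 1 / 2 * κ ^ β) (by linarith)
    (Eventually.of_forall fun n => (hpos n).ne') ?_).tendsto_atTop_zero
  have h1 := (hlim.rpow_const (p := β) (Or.inl hκ.ne')).const_mul (1 / 2)
  refine h1.congr fun n => ?_
  rw [Real.norm_of_nonneg (hpos _).le, Real.norm_of_nonneg (hpos _).le,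
    Real.div_rpow (hr _).le (hr _).le, pow_succ]
  have := Real.rpow_pos_of_pos (hr n) β
  field_simp

lemma tendsto_scale_atTop {r : ℕ → ℝ} (hr : ∀ n, 0 < r n) {κ : ℝ} (hκ : 1 < κ)
    (hlim : Tendsto (fun n => r (n + 1) / r n) atTop (𝓝 κ)) : Tendsto r atTop atTop := by
  obtain ⟨c, hc1, hc2⟩ := exists_between hκ
  obtain ⟨N, hN⟩ := eventually_atTop.1 (hlim.eventually_const_lt hc2)
  rw [← tendsto_add_atTop_iff_nat N]
  refine tendsto_atTop_of_geom_le (hr _) hc1 fun n => ?_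
  have := hN (n + N) (by omega)
  rw [lt_div_iff₀ (hr _)] at this
  rw [show n + 1 + N = n + N + 1 by ring]
  exact this.le

/-- Upper bound for the Blumenthal-Getoor index: if the real parts `∫ (1 - cos (δ rₙ x)) ν(dx)` of
the exponent are `O(2ⁿ)` along scales `rₙ` with `rₙ₊₁ / rₙ → κ > 1`, then the small jumps have
moments of all orders `β` with `κ ^ β > 2`. A jump of size `|x|` is charged to the scale `rₙ` with
`rₙ |x| ≤ 1 < rₙ₊₁ |x|`, where the cosine sees it. -/
lemma lintegral_rpow_lt_top (T : LevyTriplet) {r : ℕ → ℝ} (hr : ∀ n, 0 < r n) {κ β δ K : ℝ}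
    (hκ : 1 < κ) (hlim : Tendsto (fun n => r (n + 1) / r n) atTop (𝓝 κ)) (hβ : 0 < β)
    (h2 : 2 < κ ^ β) (hδ0 : 0 < δ) (hδ1 : δ ≤ 1)
    (hK : ∀ n, ∫ x, (1 - Real.cos (δ * r n * x)) ∂T.ν ≤ K * 2 ^ n) :
    ∫⁻ x in {x : ℝ | |x| < 1}, ENNReal.ofReal (|x| ^ β) ∂T.ν < ∞ := by
  obtain ⟨N, hN⟩ := eventually_atTop.1 (hlim.eventually_lt_const (lt_add_one κ))
  set L := κ + 1 with hL
  have hL0 : 0 < L := by linarith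
  set A := 5 * L ^ 2 / δ ^ 2 with hA
  have hA0 : 0 < A := by positivity
  have hK0 : 0 ≤ K := by
    have h0 : 0 ≤ ∫ x, (1 - Real.cos (δ * r 0 * x)) ∂T.ν :=
      integral_nonneg fun x => by simpa using Real.cos_le_one (δ * r 0 * x)
    have := hK 0
    rw [pow_zero, mul_one] at this
    exact h0.trans this
  have hrtop := tendsto_scale_atTop hr hκ hlim
  have hpt : ∀ x : ℝ, |x| < 1 → ENNReal.ofReal (|x| ^ β) ≤
      ∑' n : ℕ, ENNReal.ofReal (A * r n ^ (-β) * (1 - Real.cos (δ * r n * x)))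
        + ENNReal.ofReal (r N ^ 2 * min (x ^ 2) 1) := by
    intro x hx1
    rcases (abs_nonneg x).eq_or_lt with h0 | h0
    · rw [← h0, Real.zero_rpow hβ.ne']; simp
    rcases lt_or_ge 1 (r N * |x|) with hbig | hsmall
    · refine le_trans (ENNReal.ofReal_le_ofReal ?_) le_add_self
      have hx2 : x ^ 2 ≤ 1 := by rw [← sq_abs]; exact pow_le_one₀ (abs_nonneg x) hx1.le
      rw [min_eq_left hx2, ← sq_abs x, ← mul_pow]
      exact (Real.rpow_le_one (abs_nonneg x) hx1.le hβ.le).trans (one_le_pow₀ hbig.le)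
    classical
    have hex : ∃ m : ℕ, 1 < r (N + m) * |x| := by
      obtain ⟨n, hn, hnN⟩ := ((hrtop.eventually_gt_atTop (1 / |x|)).and
        (eventually_ge_atTop N)).exists
      refine ⟨n - N, ?_⟩
      rw [Nat.add_sub_cancel' hnN]
      rwa [div_lt_iff₀ h0] at hn
    obtain ⟨n, hnN, hn1, hn2⟩ : ∃ n, N ≤ n ∧ r n * |x| ≤ 1 ∧ 1 < r (n + 1) * |x| := by
      rcases hk : Nat.find hex with _ | k
      · have := Nat.find_spec hex
        rw [hk, add_zero] at this
        linarith
      · refine ⟨N + k, by omega, not_lt.1 (Nat.find_min hex (m := k) (by omega)), ?_⟩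
        have := Nat.find_spec hex
        rwa [hk, ← add_assoc] at this
    have hn3 : 1 < L * (r n * |x|) := by
      have h := hN n hnN
      rw [div_lt_iff₀ (hr n)] at h
      nlinarith
    refine le_trans ?_ (le_add_right (ENNReal.le_tsum n))
    refine ENNReal.ofReal_le_ofReal ?_
    have habs : |δ * r n * x| = δ * (r n * |x|) := by
      rw [abs_mul, abs_of_pos (mul_pos hδ0 (hr n)), mul_assoc]
    have hcos := sq_div_five_le_one_sub_cos (y := δ * r n * x) (by
      rw [habs]; exact (mul_le_one₀ hδ1 (mul_nonneg (hr n).le h0.le) hn1).trans one_le_two)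
    rw [← sq_abs, habs] at hcos
    have hone : 1 ≤ A * (1 - Real.cos (δ * r n * x)) := by
      refine le_trans ?_ (mul_le_mul_of_nonneg_left hcos hA0.le)
      have e : A * ((δ * (r n * |x|)) ^ 2 / 5) = (L * (r n * |x|)) ^ 2 := by
        rw [hA]; field_simp
      rw [e]
      exact one_le_pow₀ hn3.le
    have hxr : |x| ^ β ≤ r n ^ (-β) := by
      rw [Real.rpow_neg (hr n).le, ← Real.inv_rpow (hr n).le]
      refine Real.rpow_le_rpow h0.le ?_ hβ.le
      rw [le_inv_comm₀ h0 (hr n), ← one_div, le_div_iff₀ h0]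
      exact hn1
    have hrp := Real.rpow_pos_of_pos (hr n) (-β)
    nlinarith
  have hmeas : ∀ n : ℕ, Measurable fun x : ℝ =>
      ENNReal.ofReal (A * r n ^ (-β) * (1 - Real.cos (δ * r n * x))) := fun n => by fun_prop
  have hterm : ∀ n : ℕ, ∫⁻ x, ENNReal.ofReal (A * r n ^ (-β) * (1 - Real.cos (δ * r n * x))) ∂T.ν
      ≤ ENNReal.ofReal (A * K * (2 ^ n * r n ^ (-β))) := by
    intro n
    have hrp := Real.rpow_pos_of_pos (hr n) (-β)
    rw [← ofReal_integral_eq_lintegral_ofReal ((T.integrable_one_sub_cos (δ * r n)).const_mul _)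
      (Eventually.of_forall fun x => mul_nonneg (by positivity)
        (by linarith [Real.cos_le_one (δ * r n * x)])), integral_const_mul]
    refine ENNReal.ofReal_le_ofReal ?_
    calc A * r n ^ (-β) * ∫ x, (1 - Real.cos (δ * r n * x)) ∂T.ν
        ≤ A * r n ^ (-β) * (K * 2 ^ n) := by
          exact mul_le_mul_of_nonneg_left (hK n) (by positivity)
      _ = _ := by ring
  have hsum : Summable fun n : ℕ => A * K * (2 ^ n * r n ^ (-β)) :=
    (summable_two_pow_mul_rpow_neg hr (by linarith) hlim h2).mul_left _
  calc ∫⁻ x in {x : ℝ | |x| < 1}, ENNReal.ofReal (|x| ^ β) ∂T.ν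
      ≤ ∫⁻ x in {x : ℝ | |x| < 1},
        (∑' n : ℕ, ENNReal.ofReal (A * r n ^ (-β) * (1 - Real.cos (δ * r n * x)))
        + ENNReal.ofReal (r N ^ 2 * min (x ^ 2) 1)) ∂T.ν :=
        setLIntegral_mono' LevyTriplet.measurableSet_abs_lt_one hpt
    _ ≤ ∫⁻ x, (∑' n : ℕ, ENNReal.ofReal (A * r n ^ (-β) * (1 - Real.cos (δ * r n * x)))
        + ENNReal.ofReal (r N ^ 2 * min (x ^ 2) 1)) ∂T.ν := setLIntegral_le_lintegral _ _
    _ = ∑' n : ℕ, ∫⁻ x, ENNReal.ofReal (A * r n ^ (-β) * (1 - Real.cos (δ * r n * x))) ∂T.ν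
        + ∫⁻ x, ENNReal.ofReal (r N ^ 2 * min (x ^ 2) 1) ∂T.ν := by
        rw [lintegral_add_left (Measurable.tsum hmeas),
          lintegral_tsum fun n => (hmeas n).aemeasurable]
    _ < ∞ := by
        refine ENNReal.add_lt_top.2 ⟨?_, (T.integrable_min_sq_one.const_mul _).lintegral_lt_top⟩
        exact (ENNReal.tsum_le_tsum hterm).trans_lt
          (lt_top_iff_ne_top.2 hsum.tsum_ofReal_ne_top)

/-- Lower bound for the Blumenthal-Getoor index: a moment of order `β` of the small jumps with
`κ ^ β < 2` makes the exponent `o(2ⁿ)` along the scales `rₙ`. For `β < 1` the linear drift has to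
vanish. -/
lemma tendsto_half_pow_mul_exponent (T : LevyTriplet) (hσ : T.σ = 0) {r : ℕ → ℝ}
    (hr : ∀ n, 0 < r n) {κ β : ℝ} (hκ : 1 < κ)
    (hlim : Tendsto (fun n => r (n + 1) / r n) atTop (𝓝 κ)) (h0 : 0 < β) (hle : β ≤ 2)
    (h2 : κ ^ β < 2) (hm : ∫⁻ x in {x : ℝ | |x| < 1}, ENNReal.ofReal (|x| ^ β) ∂T.ν < ∞)
    (hd : 1 ≤ β ∨ T.drift = 0) {θ : ℝ} (hθ : θ ≠ 0) :
    Tendsto (fun n : ℕ => T.exponent 0 (((r n * θ : ℝ) : ℂ) * Complex.I)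
      * ((1 / 2 : ℝ) ^ n : ℝ)) atTop (𝓝 0) := by
  obtain ⟨C, hC, hgrow⟩ := T.norm_exponent_le_rpow hσ h0 hle hm hd
  have h1 := (tendsto_half_pow_mul_rpow hr (by linarith) hlim h2).const_mul (C * |θ| ^ β)
  rw [mul_zero] at h1
  refine squeeze_zero_norm' ?_ h1
  have hθ0 : 0 < |θ| := abs_pos.2 hθ
  filter_upwards [(tendsto_scale_atTop hr hκ hlim).eventually_ge_atTop (1 / |θ|)] with n hn
  rw [div_le_iff₀ hθ0] at hn
  have habs : |r n * θ| = r n * |θ| := by rw [abs_mul, abs_of_pos (hr n)]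
  have h3 := hgrow (r n * θ) (by rw [habs]; exact hn)
  rw [habs, Real.mul_rpow (hr n).le hθ0.le] at h3
  rw [norm_mul, Complex.norm_real, Real.norm_of_nonneg (by positivity)]
  calc _ ≤ C * (r n ^ β * |θ| ^ β) * (1 / 2) ^ n := by gcongr
    _ = _ := by ring

lemma lintegral_rpow_mono_exponent (T : LevyTriplet) {β β' : ℝ} (h : β ≤ β')
    (h0 : 0 < β) (hm : ∫⁻ x in {x : ℝ | |x| < 1}, ENNReal.ofReal (|x| ^ β) ∂T.ν < ∞) :
    ∫⁻ x in {x : ℝ | |x| < 1}, ENNReal.ofReal (|x| ^ β') ∂T.ν < ∞ := by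
  refine (setLIntegral_mono' LevyTriplet.measurableSet_abs_lt_one fun x hx => ?_).trans_lt hm
  refine ENNReal.ofReal_le_ofReal ?_
  exact Real.rpow_le_rpow_of_exponent_ge_of_imp (abs_nonneg x) (le_of_lt hx) h
    fun _ h' => by linarith

lemma lintegral_sq_lt_top (T : LevyTriplet) :
    ∫⁻ x in {x : ℝ | |x| < 1}, ENNReal.ofReal (|x| ^ (2 : ℝ)) ∂T.ν < ∞ := by
  refine lt_of_le_of_lt ?_ T.ν_lt_top
  refine (setLIntegral_mono' LevyTriplet.measurableSet_abs_lt_one fun x hx => ?_).trans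
    (setLIntegral_le_lintegral {x : ℝ | |x| < 1} _)
  have hx2 : x ^ 2 ≤ 1 := by rw [← sq_abs]; exact pow_le_one₀ (abs_nonneg x) (le_of_lt hx)
  rw [min_eq_left hx2, Real.rpow_ofNat, sq_abs]

end LevyZoom

/-! ### The index -/

theorem corollary4p3
    {Ω : Type*} [MeasurableSpace Ω] (P : Measure Ω) [IsProbabilityMeasure P]
    (Y : ℝ≥0 → Ω → ℝ) (ζ : Ω → ℝ≥0∞) (q : ℝ≥0) (T : LevyZoom.LevyTriplet)
    (hY : LevyZoom.IsKilledLevyProcess Y ζ q P)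
    (hT : LevyZoom.HasLevyExponent (LevyZoom.killed Y ζ) P (T.exponent q))
    {Ω' : Type*} [MeasurableSpace Ω'] (P' : Measure Ω') [IsProbabilityMeasure P']
    (Y' : ℝ≥0 → Ω' → ℝ) (ζ' : Ω' → ℝ≥0∞) (q' : ℝ≥0) (ψ' : ℂ → ℂ)
    (hY' : LevyZoom.IsKilledLevyProcess Y' ζ' q' P')
    (hψ' : LevyZoom.HasLevyExponent (LevyZoom.killed Y' ζ') P' ψ')
    (hnt : ¬ LevyZoom.IsTrivialProcess (LevyZoom.killed Y' ζ') P')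
    (α : ℝ) (hα : 0 < α)
    (hss : LevyZoom.IsSelfSimilar (LevyZoom.killed Y' ζ') P' (1 / α))
    (a : ℝ → ℝ)
    (hattr : LevyZoom.IsAttracted (T.exponent q) ψ' a)
    (hσ : ¬ 0 < T.σ)
    (hdrift : ¬ (LevyZoom.IsBV (LevyZoom.killed Y ζ) P ∧ T.drift ≠ 0)) :
    T.blumenthalGetoor = α := by
  have hσ0 : T.σ = 0 := le_antisymm (not_lt.1 hσ) T.σ_nonneg
  -- the scales `rₙ = 1 / a(2⁻ⁿ)` and the limit exponent on the imaginary axis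
  set r : ℕ → ℝ := fun n => 1 / a ((1 / 2) ^ n) with hr_def
  have hr : ∀ n, 0 < r n := fun n => one_div_pos.2 (hattr.1 _ (by positivity))
  set Ψ : ℝ → ℂ := fun θ => ψ' (θ * Complex.I) with hΨ_def
  set E : ℝ → ℂ := fun θ => T.exponent 0 (θ * Complex.I) with hE_def
  have hhalf : Tendsto (fun n : ℕ => (1 / 2 : ℝ) ^ n) atTop (𝓝 0) :=
    tendsto_pow_atTop_nhds_zero_of_lt_one (by norm_num) (by norm_num)
  have hhalf' : Tendsto (fun n : ℕ => (1 / 2 : ℝ) ^ n) atTop (𝓝[>] 0) :=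
    tendsto_nhdsWithin_iff.2 ⟨hhalf, Eventually.of_forall fun n => by
      simp only [Set.mem_Ioi]; positivity⟩
  -- the killing rate disappears in the limit
  have hElim : ∀ θ, Tendsto (fun n : ℕ => E (r n * θ) * ((1 / 2 : ℝ) ^ n : ℝ)) atTop
      (𝓝 (Ψ θ)) := by
    intro θ
    have h1 := (hattr.2 θ).comp hhalf'
    have h2 : Tendsto (fun n : ℕ => ((q : ℝ) : ℂ) * (((1 / 2 : ℝ) ^ n : ℝ) : ℂ)) atTop (𝓝 0) := by
      have := ((Complex.continuous_ofReal.tendsto 0).comp hhalf).const_mul ((q : ℝ) : ℂ)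
      simpa only [Function.comp_def, Complex.ofReal_zero, mul_zero] using this
    have h3 := h1.add h2
    rw [add_zero] at h3
    refine h3.congr fun n => ?_
    have e : ((θ : ℂ) * Complex.I) / (a ((1 / 2) ^ n) : ℂ)
        = ((r n * θ : ℝ) : ℂ) * Complex.I := by
      rw [hr_def]; push_cast; ring
    simp only [Function.comp, e, hE_def]
    rw [T.exponent_eq_sub q]
    ring
  have hΨ0 : Ψ 0 = 0 := by
    have h1 := hElim 0
    have h2 : ∀ n : ℕ, E (r n * 0) * (((1 / 2 : ℝ) ^ n : ℝ) : ℂ) = 0 := by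
      intro n; simp [hE_def, LevyZoom.LevyTriplet.exponent]
    exact (tendsto_nhds_unique (h1.congr h2) tendsto_const_nhds)
  have hq' : q' = 0 := by
    have := Measure.isProbabilityMeasure_map (μ := P') (hY'.levy.measurable 1).aemeasurable
    have h1 := hY'.charFun_eq hψ' 1 0
    have h0 : ψ' (((0 : ℝ) : ℂ) * Complex.I) = 0 := hΨ0
    rw [h0, charFun_zero, probReal_univ, zero_add, NNReal.coe_one, Complex.ofReal_one, mul_one,
      ← Complex.ofReal_exp] at h1
    have h2 : Real.exp q' = 1 := by exact_mod_cast h1.symm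
    exact_mod_cast Real.exp_eq_one_iff _ |>.1 h2
  have hΨmul : ∀ c, 0 ≤ c → ∀ θ, Ψ (c * θ) = ((c ^ α : ℝ) : ℂ) * Ψ θ := by
    intro c hc θ
    rcases hc.eq_or_lt with rfl | hc
    · rw [zero_mul, hΨ0, Real.zero_rpow hα.ne', Complex.ofReal_zero, zero_mul]
    · exact hss.exponent_mul hα hψ' hc θ
  obtain ⟨θ₀, hθ₀⟩ : ∃ θ, Ψ θ ≠ 0 := LevyZoom.exists_exponent_ne_zero hY' hψ' hq' hnt
  have hθ₀0 : θ₀ ≠ 0 := by rintro rfl; exact hθ₀ hΨ0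
  -- the laws of `rₙ Y(2⁻ⁿ)`
  set μ : ℕ → Measure ℝ := fun n => P.map fun ω => r n * Y ((1 / 2) ^ n) ω with hμ_def
  have hμp : ∀ n, IsProbabilityMeasure (μ n) := fun n =>
    Measure.isProbabilityMeasure_map ((hY.levy.measurable _).const_mul _).aemeasurable
  have hμ : ∀ n θ, charFun (μ n) θ = Complex.exp (E (r n * θ) * ((1 / 2 : ℝ) ^ n : ℝ)) := by
    intro n θ
    rw [hμ_def, charFun_map_mul_comp (hY.levy.measurable _).aemeasurable, hY.charFun_eq hT,
      T.exponent_eq_sub q, sub_add_cancel]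
    simp [hE_def]
  have hlim : ∀ θ, Tendsto (fun n => charFun (μ n) θ) atTop (𝓝 (Complex.exp (Ψ θ))) := by
    intro θ
    simp_rw [hμ]
    exact (Complex.continuous_exp.tendsto _).comp (hElim θ)
  have hcont : Continuous fun θ => Complex.exp (Ψ θ) := by
    have := Measure.isProbabilityMeasure_map (μ := P') (hY'.levy.measurable 1).aemeasurable
    have e : (fun θ => Complex.exp (Ψ θ)) = charFun (P'.map (Y' 1)) := by
      ext θ
      rw [hY'.charFun_eq hψ', hq']
      simp [hΨ_def]
    rw [e]
    exact continuous_charFun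
  have htight := isTightMeasureSet_of_tendsto_charFun hcont.continuousAt hlim
  set κ : ℝ := 2 ^ (1 / α) with hκ_def
  have hratio : Tendsto (fun n => r (n + 1) / r n) atTop (𝓝 κ) :=
    LevyZoom.tendsto_scale_ratio hα hr hμ htight hlim hΨmul hθ₀
  have hκ : 1 < κ := Real.one_lt_rpow one_lt_two (by positivity)
  have hκpow : ∀ β, κ ^ β = 2 ^ (β / α) := fun β => by
    rw [hκ_def, ← Real.rpow_mul zero_le_two]; congr 1; ring
  -- tightness bounds the real part of the exponent along the scales
  obtain ⟨δ₀, hδ₀, hequi⟩ := LevyZoom.exists_norm_charFun_sub_le htight (half_pos one_pos)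
  set δ := min δ₀ 1 with hδ_def
  have hδ : 0 < δ := lt_min hδ₀ one_pos
  have hK : ∀ n, ∫ x, (1 - Real.cos (δ * r n * x)) ∂T.ν ≤ Real.log 2 * 2 ^ n := by
    intro n
    have h1 := hequi n 0 δ (by rw [zero_sub, abs_neg, abs_of_pos hδ]; exact min_le_left _ _)
    rw [charFun_zero, probReal_univ, Complex.ofReal_one] at h1
    have h2 : 1 / 2 ≤ ‖charFun (μ n) δ‖ := by
      have := norm_sub_norm_le (1 : ℂ) (charFun (μ n) δ)
      rw [norm_one] at this
      linarith
    rw [hμ, Complex.norm_exp, Complex.re_mul_ofReal, hE_def, T.re_exponent hσ0] at h2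
    have h3 := Real.log_le_log (by norm_num) h2
    rw [Real.log_exp, one_div, Real.log_inv] at h3
    have e : r n * δ = δ * r n := mul_comm _ _
    rw [e] at h3
    set I := ∫ x, (1 - Real.cos (δ * r n * x)) ∂T.ν
    have h4 : I * (1 / 2) ^ n ≤ Real.log 2 := by rw [one_div]; linarith
    have h5 : (0 : ℝ) < 2 ^ n := by positivity
    rw [one_div, inv_pow, ← div_eq_mul_inv, div_le_iff₀ h5] at h4
    exact h4
  have hupper : ∀ β, α < β → 0 < β ∧
      ∫⁻ x in {x : ℝ | |x| < 1}, ENNReal.ofReal (|x| ^ β) ∂T.ν < ∞ := by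
    intro β hβ
    have hβ0 : 0 < β := hα.trans hβ
    refine ⟨hβ0, LevyZoom.lintegral_rpow_lt_top T hr hκ hratio hβ0 ?_ hδ (min_le_right _ _) hK⟩
    rw [hκpow]
    exact Real.self_lt_rpow_of_one_lt one_lt_two ((one_lt_div hα).2 hβ)
  refine csInf_eq_of_forall_ge_of_forall_gt_exists_lt ⟨α + 1, hupper _ (by linarith)⟩ ?_ ?_
  · rintro β ⟨hβ0, hβ⟩
    by_contra! hlt
    -- moments of order larger than `2` carry no more information than the second moment
    have hmin : ∫⁻ x in {x : ℝ | |x| < 1}, ENNReal.ofReal (|x| ^ (min β 2)) ∂T.ν < ∞ := by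
      rcases min_choice β 2 with h | h <;> rw [h]
      · exact hβ
      · exact LevyZoom.lintegral_sq_lt_top T
    have hmin0 : 0 < min β 2 := lt_min hβ0 two_pos
    have hdr : 1 ≤ min β 2 ∨ T.drift = 0 := by
      rcases le_or_gt 1 (min β 2) with h | h
      · exact Or.inl h
      · refine Or.inr (not_not.1 fun hne => hdrift ⟨?_, hne⟩)
        exact hY.isBV T hσ0 hT (LevyZoom.lintegral_rpow_mono_exponent T h.le hmin0 hmin)
    have hpow : κ ^ (min β 2) < 2 := by
      rw [hκpow]
      have : min β 2 / α < 1 := (div_lt_one hα).2 ((min_le_left _ _).trans_lt hlt)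
      simpa using Real.rpow_lt_rpow_of_exponent_lt one_lt_two this
    exact hθ₀ (tendsto_nhds_unique (hElim θ₀)
      (LevyZoom.tendsto_half_pow_mul_exponent T hσ0 hr hκ hratio hmin0 (min_le_right _ _) hpow
        hmin hdr hθ₀0))
  · intro w hw
    exact ⟨(α + w) / 2, hupper _ (by linarith), by linarith⟩
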